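/- Let $k$ be an infinite field and $A$ a finite-dimensional $k$-algebra. Let $A\text{-mod}$ be the category of finite-dimensional left $A$-modules and $A\text{-proj}$ its full subcategory of projective modules; let $K^b(A\text{-proj})$ be the bounded homotopy category of $A\text{-proj}$ and $D^b(A\text{-mod})$ the bounded derived category of $A\text{-mod}$. For $m\ge 0$ let $C_m(A\text{-proj})$ be the full subcategory of the category of bounded complexes over $A\text{-proj}$ consisting of the complexes $X=(X^i,d^i)$ with $X^i=0$ for $i\notin\{0,\dots,m\}$ that are homotopy minimal, i.e. $\operatorname{Im} d^i\subseteq \operatorname{rad} X^{i+1}$ for all $i$. The cohomology dimension vector of $X$ is $(\dim_k H^i(X))_{i\in\mathbb Z}$. Its cohomological range is $$\mathrm{hr}(X)=\max_{i}\dim_k H^i(X)\cdot\max\{j-i+1 \mid H^i(X)\ne 0\ne H^j(X)\},$$ with $\mathrm{hr}(X)=0$ if all $H^i(X)$ vanish. * $C_m(A\text{-proj})$ is of finite representation type if it has, up to isomorphism, only finitely many indecomposable objects. $K^b(A\text{-proj})$ is discrete (respectively, $A$ is derived discrete) if for every vector $(n_i)_{i\in\mathbb Z}$ of natural numbers there are,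 up to isomorphism, only finitely many objects of $K^b(A\text{-proj})$ (respectively, of $D^b(A\text{-mod})$) with cohomology dimension vector $(n_i)$. * $C_m(A\text{-proj})$ is of strongly unbounded type if there is a strictly increasing sequence $(r_i)_{i\in\mathbb N}$ of natural numbers such that for each $i$ there are, up to isomorphism, infinitely many indecomposable objects of $C_m(A\text{-proj})$ with cohomological range $r_i$. $K^b(A\text{-proj})$ is of strongly unbounded type (respectively, $A$ is strongly derived unbounded) if there is a strictly increasing sequence $(r_i)_{i\in\mathbb N}$ of natural numbers such that for each $i$ there are, up to shift and isomorphism, infinitely many indecomposable objects of $K^b(A\text{-proj})$ (respectively, of $D^b(A\text{-mod})$) with cohomological range $r_i$. * $A$ is $\mathbf C$-dichotomic if either $C_m(A\text{-proj})$ is of finite representation type for every $m\ge 1$, or $C_{m}(A\text{-proj})$ is of strongly unbounded type for some $m\ge 1$. **Corollary.** Suppose that $A$ is $\mathbf C$-dichotomic. Then: 1. $A$ is derived discrete if and only if $K^b(A\text{-proj})$ is discrete, if and only if $C_m(A\text{-proj})$ is of finite representation type for every $m\ge 1$. 2. $A$ is strongly derived unbounded if and only if $K^b(A\text{-proj})$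 is of strongly unbounded type, if and only if $C_m(A\text{-proj})$ is of strongly unbounded type for some $m\ge 1$. -/

import Mathlib

universe v u

open CategoryTheory CategoryTheory.Limits

namespace DerivedRep

/-! ### Counting objects -/

/-- Up to the relation `r`, only finitely many `x : T` satisfy `P`. -/
def FiniteUpTo {T : Type*} (r : T → T → Prop) (P : T → Prop) : Prop :=
  ∃ S : Set T, S.Finite ∧ ∀ x, P x → ∃ y ∈ S, r x y

/-- Isomorphism of objects of a category. -/
def Isomorphic {C : Type*} [Category C] (X Y : C) : Prop := Nonempty (X ≅ Y)

/-- Isomorphism up to shift, for objects of a full subcategory of a category with shift. -/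
def IsomorphicUpToShift {C : Type*} [Category C] [HasShift C ℤ] {P : ObjectProperty C}
    (X Y : P.FullSubcategory) : Prop :=
  ∃ n : ℤ, Nonempty (X.obj ≅ (shiftFunctor C n).obj Y.obj)

/-- An object is indecomposable if it is nonzero, and whenever it is a direct sum `Y ⊕ Z`
(in the category at hand) one of `Y`, `Z` is zero. No existence of biproducts is presupposed. -/
def IsIndecomposable {C : Type*} [Category C] [Preadditive C] (X : C) : Prop :=
  ¬ IsZero X ∧ ∀ (Y Z : C) (b : BinaryBicone Y Z), Nonempty b.IsBilimit →
    Nonempty (b.pt ≅ X) → IsZero Y ∨ IsZero Z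

/-! ### Numerical invariants of a cohomology dimension vector `h i = dim_k H^i(X)` -/

/-- Cohomological length: the maximum of the `h i`. -/
noncomputable def cohLength (h : ℤ → ℕ) : ℕ := ⨆ i, h i

/-- Cohomological width: the maximum of the `j - i + 1` over all `i`, `j` with `h i ≠ 0 ≠ h j`
(and `0` for the zero vector). -/
noncomputable def cohWidth (h : ℤ → ℕ) : ℕ :=
  sSup {n : ℕ | ∃ i j : ℤ, h i ≠ 0 ∧ h j ≠ 0 ∧ (n : ℤ) = j - i + 1}

/-- Cohomological range. -/
noncomputable def cohRange (h : ℤ → ℕ) : ℕ := cohLength h * cohWidth h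

/-! ### The categories attached to an algebra -/

/-- `A-proj`: finitely generated projective left `A`-modules, as a full subcategory of the
category `A-mod` of finitely generated left `A`-modules. -/
abbrev isProj (A : Type u) [Ring A] : ObjectProperty (FGModuleCat.{u} A) :=
  fun M => Module.Projective A M

abbrev ProjCat (A : Type u) [Ring A] : Type (u + 1) := (isProj A).FullSubcategory

/-- A cochain complex is bounded if its terms vanish outside some interval. -/
def IsBoundedComplex {C : Type*} [Category C] [Preadditive C] (X : CochainComplex C ℤ) : Prop :=
  ∃ a b : ℤ, ∀ i : ℤ, i < a ∨ b < i → IsZero (X.X i)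

/-- The bounded homotopy category `K^b(A-proj)`. -/
abbrev isBoundedKb (A : Type u) [Ring A] :
    ObjectProperty (HomotopyCategory (ProjCat A) (ComplexShape.up ℤ)) :=
  fun X => IsBoundedComplex X.as

abbrev Kb (A : Type u) [Ring A] : Type (u + 1) := (isBoundedKb A).FullSubcategory

/-- A complex of projectives is homotopy minimal if `Im d^i ⊆ rad X^{i+1}` for all `i`. -/
def IsHomotopyMinimal {A : Type u} [Ring A] (X : CochainComplex (ProjCat A) ℤ) : Prop :=
  ∀ i : ℤ, LinearMap.range (X.d i (i + 1)).hom.hom.hom ≤ Module.jacobson A (X.X (i + 1)).obj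

/-- `C_m(A-proj)`: homotopy minimal complexes of projectives concentrated in degrees
`0, …, m`, as a full subcategory of the category of complexes. -/
abbrev isCm (A : Type u) [Ring A] (m : ℕ) : ObjectProperty (CochainComplex (ProjCat A) ℤ) :=
  fun X => IsHomotopyMinimal X ∧ ∀ i : ℤ, i < 0 ∨ (m : ℤ) < i → IsZero (X.X i)

abbrev Cm (A : Type u) [Ring A] (m : ℕ) : Type (u + 1) := (isCm A m).FullSubcategory

noncomputable instance (A : Type u) [Ring A] [IsNoetherianRing A] :
    HasDerivedCategory.{u + 1} (FGModuleCat.{u} A) :=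
  HasDerivedCategory.standard _

/-- The bounded derived category `D^b(A-mod)`. -/
abbrev Db (A : Type u) [Ring A] [IsNoetherianRing A] : Type (u + 1) :=
  DerivedCategory.Bounded (FGModuleCat.{u} A)

/-! ### Cohomology dimension vectors -/

/-- The dimension over `k` of a module over the `k`-algebra `A`. -/
noncomputable def dimOver (k : Type v) [Field k] {A : Type u} [Ring A] [Algebra k A]
    (M : FGModuleCat.{u} A) : ℕ :=
  Module.finrank k (RestrictScalars k A M)

/-- `i ↦ dim_k H^i(X)` for `X` in `C_m(A-proj)`. -/
noncomputable def cohDimCm (k : Type v) [Field k] {A : Type u} [Ring A] [Algebra k A]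
    [IsNoetherianRing A] {m : ℕ} (X : Cm A m) (i : ℤ) : ℕ :=
  dimOver k ((((isProj A).ι.mapHomologicalComplex (ComplexShape.up ℤ)).obj X.obj).homology i)

/-- `i ↦ dim_k H^i(X)` for `X` in `K^b(A-proj)`. -/
noncomputable def cohDimKb (k : Type v) [Field k] {A : Type u} [Ring A] [Algebra k A]
    [IsNoetherianRing A] (X : Kb A) (i : ℤ) : ℕ :=
  dimOver k ((HomotopyCategory.homologyFunctor (FGModuleCat.{u} A) (ComplexShape.up ℤ) i).obj
    (((isProj A).ι.mapHomotopyCategory (ComplexShape.up ℤ)).obj X.obj))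

/-- `i ↦ dim_k H^i(X)` for `X` in `D^b(A-mod)`. -/
noncomputable def cohDimDb (k : Type v) [Field k] {A : Type u} [Ring A] [Algebra k A]
    [IsNoetherianRing A] (X : Db A) (i : ℤ) : ℕ :=
  dimOver k ((DerivedCategory.homologyFunctor (FGModuleCat.{u} A) i).obj X.obj)

theorem noetherian_of_finite (k : Type v) [Field k] (A : Type u) [Ring A] [Algebra k A]
    [Module.Finite k A] : IsNoetherianRing A :=
  isNoetherian_of_tower k inferInstance

/-! ### Representation types of a finite-dimensional algebra -/

/-- `C_m(A-proj)` is of finite representation type. -/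
def CmFiniteType (A : Type u) [Ring A] (m : ℕ) : Prop :=
  FiniteUpTo Isomorphic fun X : Cm A m => IsIndecomposable X

/-- `K^b(A-proj)` is discrete. -/
def KbDiscrete (k : Type v) [Field k] (A : Type u) [Ring A] [Algebra k A]
    [Module.Finite k A] : Prop :=
  haveI := noetherian_of_finite k A
  ∀ h : ℤ → ℕ, FiniteUpTo Isomorphic fun X : Kb A => cohDimKb k X = h

/-- `A` is derived-discrete. -/
def DerivedDiscrete (k : Type v) [Field k] (A : Type u) [Ring A] [Algebra k A]
    [Module.Finite k A] : Prop :=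
  haveI := noetherian_of_finite k A
  ∀ h : ℤ → ℕ, FiniteUpTo Isomorphic fun X : Db A => cohDimDb k X = h

/-- `C_m(A-proj)` is of strongly unbounded type. -/
def CmStronglyUnbounded (k : Type v) [Field k] (A : Type u) [Ring A] [Algebra k A]
    [Module.Finite k A] (m : ℕ) : Prop :=
  haveI := noetherian_of_finite k A
  ∃ r : ℕ → ℕ, StrictMono r ∧ ∀ i, ¬ FiniteUpTo Isomorphic
    fun X : Cm A m => IsIndecomposable X ∧ cohRange (cohDimCm k X) = r i

/-- `K^b(A-proj)` is of strongly unbounded type. -/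
def KbStronglyUnbounded (k : Type v) [Field k] (A : Type u) [Ring A] [Algebra k A]
    [Module.Finite k A] : Prop :=
  haveI := noetherian_of_finite k A
  ∃ r : ℕ → ℕ, StrictMono r ∧ ∀ i, ¬ FiniteUpTo IsomorphicUpToShift
    fun X : Kb A => IsIndecomposable X ∧ cohRange (cohDimKb k X) = r i

/-- `A` is strongly derived unbounded. -/
def StronglyDerivedUnbounded (k : Type v) [Field k] (A : Type u) [Ring A] [Algebra k A]
    [Module.Finite k A] : Prop :=
  haveI := noetherian_of_finite k A
  ∃ r : ℕ → ℕ, StrictMono r ∧ ∀ i, ¬ FiniteUpTo IsomorphicUpToShift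
    fun X : Db A => IsIndecomposable X ∧ cohRange (cohDimDb k X) = r i

/-- `A` is `C`-dichotomic. -/
def IsCDichotomic (k : Type v) [Field k] (A : Type u) [Ring A] [Algebra k A]
    [Module.Finite k A] : Prop :=
  (∀ m : ℕ, 1 ≤ m → CmFiniteType A m) ∨ (∃ m : ℕ, 1 ≤ m ∧ CmStronglyUnbounded k A m)

end DerivedRep

namespace DerivedRep

/-! ### Counting objects -/

section Counting

/-! The two alternatives of the dichotomy exclude each other, and each decides all the other
properties; the equivalences then follow by comparing truth values.

Suppose every C_m has finite type. An object X of D^b with prescribed cohomology vector can be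
shifted into degrees 1, …, m. Truncating a projective resolution at degree 0 gives a complex P of
projectives in degrees 0, …, m and a map P → X that is an isomorphism on H^i for i ≥ 1; X is
recovered from P as the canonical truncation τ^{≥1}P (`nonempty_iso_of_approximation`). If P has
least total dimension, it is homotopy minimal and ker d^0 lies in rad P^0, so by Nakayama its
dimension is bounded in terms of the vector (`exists_minimal_approximation`). Finite type and
additivity of dimension leave finitely many such P, so A is derived discrete. Discreteness passes to
K^b by full faithfulness, and it excludes strong unboundedness because a positive cohomological
range allows only finitely many vectors up to shift.

Suppose some C_m is of strongly unbounded type. By Fitting's argument an indecomposable of C_m has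
only nilpotent or invertible endomorphisms, so it stays indecomposable in K^b and D^b
(`isIndecomposable_cmToKb`). Homotopy equivalent minimal complexes are isomorphic, and only finitely
many shifts of one object have cohomology in degrees 0, …, m only (`finiteUpTo_of_iso_shift`). Hence
the infinite families survive up to shift, and K^b is not discrete. -/

theorem FiniteUpTo.mono {T : Type*} {r : T → T → Prop} {P Q : T → Prop} (h : FiniteUpTo r P)
    (hQ : ∀ x, Q x → P x) : FiniteUpTo r Q := by
  obtain ⟨S, hS, h⟩ := h
  exact ⟨S, hS, fun x hx => h x (hQ x hx)⟩

/-- Transfer of finiteness along a relation `R` that reflects equivalence. -/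
theorem FiniteUpTo.of_rel {T T' : Type*} {r : T → T → Prop} {P : T → Prop} {r' : T' → T' → Prop}
    {P' : T' → Prop} (h : FiniteUpTo r P) (R : T' → T → Prop)
    (hR : ∀ x, P' x → ∃ p, P p ∧ R x p)
    (hr : ∀ x x' p p' y, R x p → R x' p' → r p y → r p' y → r' x x') : FiniteUpTo r' P' := by
  obtain ⟨S, hS, h⟩ := h
  let Q : T → T' → Prop := fun y x => ∃ p, R x p ∧ r p y
  -- Only the representatives that are reached from `T'` matter; one preimage of each serves as a
  -- representative in `T'`.
  let S' : Set T := {y ∈ S | ∃ x, Q y x}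
  have hS' : S'.Finite := hS.subset fun _ h => h.1
  have : Finite S' := hS'
  refine ⟨Set.range fun y : S' => y.2.2.choose, Set.finite_range _, fun x hx => ?_⟩
  obtain ⟨p, hp, hxp⟩ := hR x hx
  obtain ⟨y, hy, hpy⟩ := h p hp
  have hy' : ∃ x, Q y x := ⟨x, p, hxp, hpy⟩
  refine ⟨_, ⟨⟨y, hy, hy'⟩, rfl⟩, ?_⟩
  obtain ⟨p', hp', hpy'⟩ := hy'.choose_spec
  exact hr _ _ _ _ _ hxp hp' hpy hpy'

theorem finiteUpTo_eq_of_finite {T : Type*} {S : Set T} (hS : S.Finite) :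
    FiniteUpTo Eq (fun x => x ∈ S) :=
  ⟨S, hS, fun x hx => ⟨x, hx, rfl⟩⟩

theorem FiniteUpTo.biUnion {T ι : Type*} {r : T → T → Prop} {s : Set ι} (hs : s.Finite)
    {P : ι → T → Prop} (h : ∀ i ∈ s, FiniteUpTo r (P i)) :
    FiniteUpTo r (fun x => ∃ i ∈ s, P i x) := by
  choose! S hS h using h
  refine ⟨⋃ i ∈ s, S i, hs.biUnion hS, ?_⟩
  rintro x ⟨i, hi, hx⟩
  obtain ⟨y, hy, hxy⟩ := h i hi x hx
  exact ⟨y, Set.mem_biUnion hi hy, hxy⟩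

end Counting

/-! ### Decompositions in preadditive categories -/

section Preadditive

variable {C : Type*} [Category C] [Preadditive C]

/-- A bilimit bicone transports along isomorphisms of the summands, and its point is unique up to
isomorphism. -/
theorem nonempty_iso_pt_of_iso {Y Z Y' Z' : C} (b : BinaryBicone Y Z) (hb : b.IsBilimit)
    (b' : BinaryBicone Y' Z') (hb' : b'.IsBilimit) (e : Y ≅ Y') (f : Z ≅ Z') :
    Nonempty (b.pt ≅ b'.pt) := by
  refine ⟨⟨b.fst ≫ e.hom ≫ b'.inl + b.snd ≫ f.hom ≫ b'.inr,
    b'.fst ≫ e.inv ≫ b.inl + b'.snd ≫ f.inv ≫ b.inr, ?_, ?_⟩⟩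
  · simp [IsBilimit.binary_total hb]
  · simp [IsBilimit.binary_total hb']

/-- If an additive size function vanishes only on zero objects and there are finitely many
indecomposables, then there are finitely many objects of bounded size. -/
theorem finiteUpTo_of_size_le (size : C → ℕ) (h0 : ∀ X, size X = 0 → IsZero X)
    (hadd : ∀ (Y Z : C) (b : BinaryBicone Y Z), b.IsBilimit → size b.pt = size Y + size Z)
    (hiso : ∀ X Y : C, Nonempty (X ≅ Y) → size X = size Y)
    (hfin : FiniteUpTo Isomorphic fun X : C => IsIndecomposable X) (N : ℕ) :
    FiniteUpTo Isomorphic fun X : C => size X ≤ N := by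
  induction N with
  | zero =>
    by_cases h : ∃ X : C, size X = 0
    · obtain ⟨Z, hZ⟩ := h
      exact ⟨{Z}, Set.finite_singleton _, fun X hX =>
        ⟨Z, rfl, ⟨(h0 X (by omega)).iso (h0 Z hZ)⟩⟩⟩
    · push Not at h
      exact ⟨∅, Set.finite_empty, fun X hX => absurd (Nat.le_zero.1 hX) (h X)⟩
  | succ N ih =>
    obtain ⟨S, hS, hS'⟩ := hfin
    have hpair : FiniteUpTo Isomorphic (fun X : C => ∃ (Y Z : C) (b : BinaryBicone Y Z),
        Nonempty b.IsBilimit ∧ Nonempty (b.pt ≅ X) ∧ size Y ≤ N ∧ size Z ≤ N) := by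
      obtain ⟨T, hT, hT'⟩ := ih
      refine (finiteUpTo_eq_of_finite (hT.prod hT)).of_rel
        (fun X p => ∃ (Y Z : C) (b : BinaryBicone Y Z), Nonempty b.IsBilimit ∧
          Nonempty (b.pt ≅ X) ∧ Nonempty (Y ≅ p.1) ∧ Nonempty (Z ≅ p.2)) ?_ ?_
      · rintro X ⟨Y, Z, b, hb, e, hY, hZ⟩
        obtain ⟨Y', hY', eY⟩ := hT' Y hY
        obtain ⟨Z', hZ', eZ⟩ := hT' Z hZ
        exact ⟨(Y', Z'), ⟨hY', hZ'⟩, Y, Z, b, hb, e, eY, eZ⟩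
      · rintro X X' p p' y ⟨Y, Z, b, ⟨hb⟩, ⟨e⟩, ⟨eY⟩, ⟨eZ⟩⟩ ⟨Y', Z', b', ⟨hb'⟩, ⟨e'⟩, ⟨eY'⟩, ⟨eZ'⟩⟩
          rfl rfl
        obtain ⟨i⟩ := nonempty_iso_pt_of_iso b hb b' hb' (eY ≪≫ eY'.symm) (eZ ≪≫ eZ'.symm)
        exact ⟨e.symm ≪≫ i ≪≫ e'⟩
    obtain ⟨T, hT, hT'⟩ := hpair
    obtain ⟨U, hU, hU'⟩ := ih
    refine ⟨S ∪ T ∪ U, (hS.union hT).union hU, fun X hX => ?_⟩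
    by_cases hX0 : IsZero X
    · have : size X = 0 := by
        -- A zero object is its own biproduct with itself, so its size is twice itself.
        have := hadd X X ⟨X, 𝟙 X, 0, 𝟙 X, 0, by simp, hX0.eq_of_src _ _, hX0.eq_of_src _ _,
          hX0.eq_of_src _ _⟩ (isBinaryBilimitOfTotal _ (hX0.eq_of_src _ _))
        simp only at this
        omega
      obtain ⟨y, hy, h⟩ := hU' X (by omega)
      exact ⟨y, Or.inr hy, h⟩
    by_cases hX1 : IsIndecomposable X
    · obtain ⟨y, hy, h⟩ := hS' X hX1
      exact ⟨y, Or.inl (Or.inl hy), h⟩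
    · rw [IsIndecomposable] at hX1
      push Not at hX1
      obtain ⟨Y, Z, b, ⟨hb⟩, ⟨e⟩, hY, hZ⟩ := hX1 hX0
      have h1 := hadd Y Z b hb
      have h2 := hiso _ _ ⟨e⟩
      have h3 : size Y ≠ 0 := fun h => hY (h0 _ h)
      have h4 : size Z ≠ 0 := fun h => hZ (h0 _ h)
      obtain ⟨y, hy, h⟩ := hT' X ⟨Y, Z, b, ⟨hb⟩, ⟨e⟩, by omega, by omega⟩
      exact ⟨y, Or.inl (Or.inr hy), h⟩

/-- A decomposition of X yields the idempotent projecting onto the first summand; if it is 0 or 1,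
one summand vanishes. -/
theorem isIndecomposable_of_idempotents {X : C} (hX : ¬ IsZero X)
    (h : ∀ q : X ⟶ X, q ≫ q = q → q = 0 ∨ q = 𝟙 X) : IsIndecomposable X := by
  refine ⟨hX, ?_⟩
  rintro Y Z b ⟨hb⟩ ⟨e⟩
  rcases h (e.inv ≫ b.fst ≫ b.inl ≫ e.hom) (by simp) with h | h
  · left
    rw [IsZero.iff_id_eq_zero]
    have : 𝟙 Y = b.inl ≫ e.hom ≫ (e.inv ≫ b.fst ≫ b.inl ≫ e.hom) ≫ e.inv ≫ b.fst := by simp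
    rw [this, h]
    simp
  · right
    rw [IsZero.iff_id_eq_zero]
    have : 𝟙 Z = b.inr ≫ e.hom ≫ 𝟙 _ ≫ e.inv ≫ b.snd := by simp
    rw [this, ← h]
    simp

/-- Splitting both q and 1 - q exhibits X as the biproduct of their images. -/
theorem IsIndecomposable.idempotent_eq [IsIdempotentComplete C] {X : C} (hX : IsIndecomposable X)
    (q : X ⟶ X) (hq : q ≫ q = q) : q = 0 ∨ q = 𝟙 X := by
  obtain ⟨Y, i, p, hip, hpi⟩ := IsIdempotentComplete.idempotents_split X q hq
  obtain ⟨Z, j, s, hjs, hsj⟩ := IsIdempotentComplete.idempotents_split X (𝟙 X - q)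
    (by simp [hq])
  have hiq : i ≫ q = i := by rw [← hpi, reassoc_of% hip]
  have hqp : q ≫ p = p := by rw [← hpi, Category.assoc, hip, Category.comp_id]
  have hjq : j ≫ q = 0 := by
    have : j ≫ (𝟙 X - q) = j := by rw [← hsj, reassoc_of% hjs]
    simpa using this
  have hqs : q ≫ s = 0 := by
    have : (𝟙 X - q) ≫ s = s := by rw [← hsj, Category.assoc, hjs, Category.comp_id]
    simpa using this
  let b : BinaryBicone Y Z :=
    { pt := X, fst := p, snd := s, inl := i, inr := j
      inl_fst := hip
      inl_snd := by rw [← hiq, Category.assoc, hqs, comp_zero]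
      inr_fst := by rw [← hqp, ← Category.assoc, hjq, zero_comp]
      inr_snd := hjs }
  have hb : b.IsBilimit := isBinaryBilimitOfTotal b (by
    change p ≫ i + s ≫ j = 𝟙 X
    rw [hpi, hsj]; abel)
  rcases hX.2 Y Z b ⟨hb⟩ ⟨Iso.refl _⟩ with h | h
  · left
    rw [← hpi, h.eq_of_tgt p 0, zero_comp]
  · right
    have : 𝟙 X - q = 0 := by rw [← hsj, h.eq_of_tgt s 0, zero_comp]
    exact (sub_eq_zero.1 this).symm

end Preadditive

theorem isIdempotentComplete_fullSubcategory {C : Type*} [Category C]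
    [IsIdempotentComplete C] (P : ObjectProperty C)
    (hP : ∀ (X Y : C) (i : Y ⟶ X) (p : X ⟶ Y), i ≫ p = 𝟙 Y → P X → P Y) :
    IsIdempotentComplete P.FullSubcategory where
  idempotents_split X q hq := by
    obtain ⟨Y, i, p, hip, hpi⟩ := IsIdempotentComplete.idempotents_split X.obj q.hom
      (by rw [← ObjectProperty.FullSubcategory.comp_hom, hq])
    exact ⟨⟨Y, hP _ _ i p hip X.property⟩, ObjectProperty.homMk i, ObjectProperty.homMk p,
      by ext; exact hip, by ext; exact hpi⟩

/-! ### Modules over a finite-dimensional algebra -/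

section Modules

variable {A : Type*} [Ring A] {M N : Type*} [AddCommGroup M] [Module A M] [AddCommGroup N]
  [Module A N]

/-- A submodule which is not contained in the radical has a proper supplement which is maximal. -/
theorem exists_isCoatom_sup_eq_top {K : Submodule A M} (hK : ¬ K ≤ Module.jacobson A M) :
    ∃ L : Submodule A M, IsCoatom L ∧ K ⊔ L = ⊤ := by
  have : ∃ L : Submodule A M, IsCoatom L ∧ ¬ K ≤ L := by
    by_contra! h
    exact hK (le_sInf fun L hL => h L hL)
  obtain ⟨L, hL, hKL⟩ := this
  exact ⟨L, hL, (hL.2 _ (right_lt_sup.2 hKL))⟩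

/-- Nakayama's lemma. -/
theorem eq_top_of_sup_jacobson [Module.Finite A M] {K : Submodule A M}
    (hK : K ⊔ Module.jacobson A M = ⊤) : K = ⊤ := by
  rcases eq_top_or_exists_le_coatom K with h | ⟨L, hL, hKL⟩
  · exact h
  · have : K ⊔ Module.jacobson A M ≤ L := sup_le hKL (sInf_le hL)
    rw [hK] at this
    exact absurd (top_le_iff.1 this) hL.1

/-- The dimension of a module is bounded by the dimension of its image under a linear map whose
kernel is contained in the radical. -/
theorem finrank_le_of_ker_le_jacobson (k : Type*) [Field k] [Algebra k A] [Module.Finite k A]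
    [Module k M] [IsScalarTower k A M] [Module k N] [IsScalarTower k A N] [Module.Finite A M]
    [Module.Finite k N] (f : M →ₗ[A] N) (hf : LinearMap.ker f ≤ Module.jacobson A M) :
    Module.finrank k M ≤ Module.finrank k N * Module.finrank k A := by
  let R := LinearMap.range (f.restrictScalars k)
  let n := Module.finrank k R
  let b : Module.Basis (Fin n) k R := Module.finBasis k R
  choose x hx using fun i : Fin n => (b i).2
  -- Lifts of a k-basis of the image generate M modulo the kernel, hence modulo the radical, hence
  -- generate M by Nakayama. So M is a quotient of a free module whose rank is the dimension of the
  -- image.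
  have hspan : Submodule.span A (Set.range x) = ⊤ := by
    apply eq_top_of_sup_jacobson
    rw [eq_top_iff]
    refine le_trans ?_ (sup_le_sup_left hf _)
    intro m _
    let c : Fin n → k := fun i => b.repr ⟨f m, m, rfl⟩ i
    have hm : f m = ∑ i, c i • (b i : N) := by
      have := congrArg Subtype.val (b.sum_repr ⟨f m, m, rfl⟩)
      refine this.symm.trans ?_
      rw [Submodule.coe_sum]
      rfl
    have h1 : m - ∑ i, algebraMap k A (c i) • x i ∈ LinearMap.ker f := by
      rw [LinearMap.mem_ker, map_sub, map_sum, sub_eq_zero, hm]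
      refine Finset.sum_congr rfl fun i _ => ?_
      rw [map_smul, algebraMap_smul]
      exact congrArg _ (hx i).symm
    have h2 : ∑ i, algebraMap k A (c i) • x i ∈ Submodule.span A (Set.range x) :=
      Submodule.sum_mem _ fun i _ => Submodule.smul_mem _ _ (Submodule.subset_span ⟨i, rfl⟩)
    simpa using Submodule.add_mem_sup h2 h1
  let g : (Fin n → A) →ₗ[A] M := Fintype.linearCombination A x
  have hg : Function.Surjective g := by
    rw [← LinearMap.range_eq_top, Fintype.range_linearCombination, hspan]
  have h1 := LinearMap.finrank_le_finrank_of_surjective (f := g.restrictScalars k) hg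
  rw [Module.finrank_pi_fintype, Finset.sum_const, Finset.card_univ, Fintype.card_fin,
    smul_eq_mul] at h1
  exact h1.trans (Nat.mul_le_mul_right _ (Submodule.finrank_le R))

/-- Powers of an endomorphism of a finitely generated module over a finite-dimensional algebra
are eventually group-invertible. -/
theorem exists_groupInverse (k : Type*) [Field k] [Algebra k A] [Module.Finite k A]
    [Module.Finite A M] (φ : Module.End A M) :
    ∃ n₀ : ℕ, ∀ n, n₀ ≤ n → ∃ ψ : Module.End A M,
      ψ * φ ^ n = φ ^ n * ψ ∧ ψ * φ ^ n * ψ = ψ ∧ φ ^ n * ψ * φ ^ n = φ ^ n := by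
  let _ : Module k M := Module.compHom M (algebraMap k A)
  have : IsScalarTower k A M := ⟨fun c a m => by
    rw [Algebra.smul_def, mul_smul]; rfl⟩
  have : SMulCommClass A k M := IsScalarTower.to_smulCommClass'
  have : Module.Finite k M := Module.Finite.trans A M
  have : Module.Finite k (Module.End A M) := by
    let ι : Module.End A M →ₗ[k] Module.End k M :=
      { toFun := fun f => f.restrictScalars k
        map_add' := fun _ _ => rfl
        map_smul' := fun _ _ => rfl }
    exact Module.Finite.of_injective ι fun f g h => by
      ext x; exact LinearMap.congr_fun h x
  let E := Algebra.adjoin k {φ}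
  have : IsMulCommutative E := Algebra.isMulCommutative_adjoin k (by simp)
  let _ : CommRing E := inferInstance
  have : IsArtinianRing E := isArtinian_of_tower k inferInstance
  let φ' : E := ⟨φ, Algebra.self_mem_adjoin_singleton k φ⟩
  -- The commutative algebra k[φ] is Artinian, so the ideals generated by the powers of φ stabilise.
  obtain ⟨n₀, y, hy⟩ := IsArtinian.exists_pow_succ_smul_dvd φ' (1 : E)
  simp only [smul_eq_mul, mul_one, Nat.succ_eq_add_one] at hy
  have h1 : ∀ n, n₀ ≤ n → φ' ^ n = φ' ^ (n + 1) * y := by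
    intro n hn
    obtain ⟨j, rfl⟩ := Nat.exists_eq_add_of_le hn
    rw [pow_add, ← hy]; ring
  have h2 : ∀ n, n₀ ≤ n → ∀ j, φ' ^ n = φ' ^ (n + j) * y ^ j := by
    intro n hn j
    induction j with
    | zero => simp
    | succ j ih => rw [ih, h1 (n + j) (by omega)]; ring
  -- From φ^n = φ^{2n} y^n, the product of φ^n with φ^n y^{2n} is the idempotent φ^n y^n, which
  -- fixes φ^n.
  refine ⟨n₀, fun n hn => ⟨(φ' ^ n * y ^ (2 * n) : E), ?_⟩⟩
  have key := h2 n hn n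
  have e1 : (φ' ^ n * y ^ (2 * n)) * φ' ^ n = φ' ^ n * (φ' ^ n * y ^ (2 * n)) := by ring
  have e2 : (φ' ^ n * y ^ (2 * n)) * φ' ^ n * (φ' ^ n * y ^ (2 * n)) = φ' ^ n * y ^ (2 * n) := by
    have : (φ' ^ n * y ^ (2 * n)) * φ' ^ n * (φ' ^ n * y ^ (2 * n))
      = ((φ' ^ (n + n) * y ^ n) * φ' ^ n * y ^ n) * y ^ (2 * n) := by ring
    rw [this, ← key, ← pow_add, ← key]
  have e3 : φ' ^ n * (φ' ^ n * y ^ (2 * n)) * φ' ^ n = φ' ^ n := by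
    have : φ' ^ n * (φ' ^ n * y ^ (2 * n)) * φ' ^ n = (φ' ^ (n + n) * y ^ n) * φ' ^ n * y ^ n := by
      ring
    rw [this, ← key, ← pow_add, ← key]
  exact ⟨congrArg Subtype.val e1, congrArg Subtype.val e2, congrArg Subtype.val e3⟩

end Modules

/-- Group inverses are natural. -/
theorem groupInverse_natural {C : Type*} [Category C] {X Y : C} {a a' : X ⟶ X} {b b' : Y ⟶ Y}
    {d : X ⟶ Y} (hd : a ≫ d = d ≫ b) (ha : a' ≫ a = a ≫ a') (ha1 : a' ≫ a ≫ a' = a')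
    (hb : b' ≫ b = b ≫ b') (hb1 : b' ≫ b ≫ b' = b') (ha2 : a ≫ a' ≫ a = a)
    (hb2 : b ≫ b' ≫ b = b) : a' ≫ d = d ≫ b' := by
  have hb3 : b ≫ b ≫ b' = b := by rw [← hb, hb2]
  have ha3 : a' ≫ a ≫ a = a := by rw [reassoc_of% ha, ha2]
  -- Both sides of the claim equal `a' ≫ a ≫ d ≫ b'`: first insert the idempotent of b on the right,
  -- then that of a on the left.
  have h1 : a' ≫ d = a' ≫ a ≫ d ≫ b' := by
    calc a' ≫ d = (a' ≫ a ≫ a') ≫ d := by rw [ha1]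
      _ = a' ≫ a' ≫ d ≫ b := by
        rw [← ha, Category.assoc, Category.assoc, hd]
      _ = a' ≫ a' ≫ d ≫ b ≫ b ≫ b' := by rw [hb3]
      _ = a' ≫ (a' ≫ a ≫ a) ≫ d ≫ b' := by
        rw [← reassoc_of% hd, ← reassoc_of% hd]; simp only [Category.assoc]
      _ = _ := by rw [ha3]
  have h2 : d ≫ b' = a' ≫ a ≫ d ≫ b' := by
    calc d ≫ b' = d ≫ b' ≫ b ≫ b' := by rw [hb1]
      _ = a ≫ d ≫ b' ≫ b' := by rw [reassoc_of% hb, ← reassoc_of% hd]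
      _ = (a' ≫ a ≫ a) ≫ d ≫ b' ≫ b' := by rw [ha3]
      _ = a' ≫ a ≫ d ≫ b' ≫ b ≫ b' := by
        simp only [Category.assoc]; rw [reassoc_of% hd, ← reassoc_of% hb]
      _ = _ := by rw [hb1]
  rw [h1, ← h2]

/-! ### Dimensions of modules -/

section Dimension

variable (k : Type v) [Field k] {A : Type u} [Ring A] [Algebra k A]

/-- The `k`-vector space underlying a module over a `k`-algebra. -/
@[reducible]
def moduleOver (M : FGModuleCat.{u} A) : Module k M := Module.compHom M (algebraMap k A)

attribute [local instance] moduleOver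

theorem isScalarTower_moduleOver (M : FGModuleCat.{u} A) : IsScalarTower k A M :=
  ⟨fun c a m => by rw [Algebra.smul_def, mul_smul]; rfl⟩

attribute [local instance] isScalarTower_moduleOver

theorem dimOver_eq_finrank (M : FGModuleCat.{u} A) : dimOver k M = Module.finrank k M := rfl

variable [Module.Finite k A]

theorem finite_moduleOver (M : FGModuleCat.{u} A) : Module.Finite k M :=
  Module.Finite.trans A _

attribute [local instance] finite_moduleOver

theorem dimOver_le_of_injective {M N : FGModuleCat.{u} A} (f : M →ₗ[A] N)
    (hf : Function.Injective f) : dimOver k M ≤ dimOver k N := by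
  rw [dimOver_eq_finrank, dimOver_eq_finrank]
  exact LinearMap.finrank_le_finrank_of_injective (f := f.restrictScalars k) hf

theorem bijective_of_injective_of_dimOver_le {M N : FGModuleCat.{u} A} (f : M →ₗ[A] N)
    (hf : Function.Injective f) (h : dimOver k N ≤ dimOver k M) : Function.Bijective f := by
  have h' := le_antisymm (dimOver_le_of_injective k f hf) h
  rw [dimOver_eq_finrank, dimOver_eq_finrank] at h'
  exact ⟨hf, (LinearMap.injective_iff_surjective_of_finrank_eq_finrank
    (f := f.restrictScalars k) h').1 hf⟩

theorem dimOver_eq_of_iso {M N : FGModuleCat.{u} A} (e : M ≅ N) : dimOver k M = dimOver k N :=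
  le_antisymm (dimOver_le_of_injective k (FGModuleCat.isoToLinearEquiv e).toLinearMap
      (FGModuleCat.isoToLinearEquiv e).injective)
    (dimOver_le_of_injective k (FGModuleCat.isoToLinearEquiv e).symm.toLinearMap
      (FGModuleCat.isoToLinearEquiv e).symm.injective)

theorem isZero_of_dimOver_eq_zero {M : FGModuleCat.{u} A} (h : dimOver k M = 0) : IsZero M := by
  have : Subsingleton M := Module.finrank_zero_iff.1 h
  rw [IsZero.iff_id_eq_zero]
  ext x
  exact Subsingleton.elim _ _

omit [Module.Finite k A] in
theorem subsingleton_of_isZero {M : FGModuleCat.{u} A} (h : IsZero M) : Subsingleton M := by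
  refine ⟨fun x y => ?_⟩
  have h1 : 𝟙 M = 0 := h.eq_of_src _ _
  have h2 : ∀ z : M, z = 0 := fun z => congrArg (fun f : M ⟶ M => f.hom.hom z) h1
  rw [h2 x, h2 y]

omit [Module.Finite k A] in
theorem dimOver_eq_zero_of_isZero {M : FGModuleCat.{u} A} (h : IsZero M) : dimOver k M = 0 := by
  have : Subsingleton M := subsingleton_of_isZero h
  rw [dimOver_eq_finrank]
  exact Module.finrank_zero_of_subsingleton

theorem dimOver_eq_zero_iff {M : FGModuleCat.{u} A} : dimOver k M = 0 ↔ IsZero M :=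
  ⟨isZero_of_dimOver_eq_zero k, dimOver_eq_zero_of_isZero k⟩

theorem dimOver_le_add {M N P : FGModuleCat.{u} A} (f : M →ₗ[A] N) (g : N →ₗ[A] P)
    (h : ∀ x, g x = 0 → ∃ y, f y = x) : dimOver k N ≤ dimOver k M + dimOver k P := by
  have h1 := LinearMap.finrank_range_add_finrank_ker (g.restrictScalars k)
  have h2 : Module.finrank k (LinearMap.range (g.restrictScalars k)) ≤ dimOver k P :=
    Submodule.finrank_le _
  have h3 : Module.finrank k (LinearMap.ker (g.restrictScalars k)) ≤
      Module.finrank k (LinearMap.range (f.restrictScalars k)) :=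
    Submodule.finrank_mono fun x hx => h x hx
  have h4 : Module.finrank k (LinearMap.range (f.restrictScalars k)) ≤ dimOver k M :=
    LinearMap.finrank_range_le _
  rw [dimOver_eq_finrank k N]
  omega

theorem dimOver_biprod {M N : FGModuleCat.{u} A} (b : BinaryBicone M N) (hb : b.IsBilimit) :
    dimOver k b.pt = dimOver k M + dimOver k N := by
  have h1 : ∀ x, b.fst.hom.hom (b.inl.hom.hom x) = x := fun x =>
    congrArg (fun f : M ⟶ M => f.hom.hom x) b.inl_fst
  have h2 : ∀ x, b.snd.hom.hom (b.inr.hom.hom x) = x := fun x =>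
    congrArg (fun f : N ⟶ N => f.hom.hom x) b.inr_snd
  have h3 : ∀ x, b.fst.hom.hom (b.inr.hom.hom x) = 0 := fun x =>
    congrArg (fun f : N ⟶ M => f.hom.hom x) b.inr_fst
  have h4 : ∀ x, b.snd.hom.hom (b.inl.hom.hom x) = 0 := fun x =>
    congrArg (fun f : M ⟶ N => f.hom.hom x) b.inl_snd
  have h5 : ∀ x, b.inl.hom.hom (b.fst.hom.hom x) + b.inr.hom.hom (b.snd.hom.hom x) = x := fun x =>
    congrArg (fun f : b.pt ⟶ b.pt => f.hom.hom x) (IsBilimit.binary_total hb)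
  let e : b.pt ≃ₗ[k] M × N :=
    LinearEquiv.ofBijective ((b.fst.hom.hom.restrictScalars k).prod (b.snd.hom.hom.restrictScalars k)) (by
      constructor
      · intro x y hxy
        have hx : b.fst.hom.hom x = b.fst.hom.hom y := congrArg Prod.fst hxy
        have hy : b.snd.hom.hom x = b.snd.hom.hom y := congrArg Prod.snd hxy
        rw [← h5 x, ← h5 y, hx, hy]
      · rintro ⟨x, y⟩
        refine ⟨(b.inl.hom.hom x + b.inr.hom.hom y : b.pt), Prod.ext ?_ ?_⟩
        · exact (map_add b.fst.hom.hom _ _).trans (by erw [h1, h3, add_zero])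
        · exact (map_add b.snd.hom.hom _ _).trans (by erw [h2, h4, zero_add]))
  exact e.finrank_eq.trans Module.finrank_prod

theorem dimOver_le_of_le_jacobson {M N : FGModuleCat.{u} A} (f : M →ₗ[A] N)
    (hK : LinearMap.ker f ≤ Module.jacobson A M) :
    dimOver k M ≤ dimOver k N * Module.finrank k A := by
  rw [dimOver_eq_finrank, dimOver_eq_finrank]
  exact finrank_le_of_ker_le_jacobson k f hK

end Dimension

/-! ### Exactness and dimension estimates for complexes of modules. -/

section Homology

variable {A : Type u} [Ring A] [IsNoetherianRing A]

theorem exact_iff_fgModuleCat {S : ShortComplex (FGModuleCat.{u} A)} (hS : S.Exact) (x : S.X₂)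
    (hx : S.g.hom.hom x = 0) : ∃ y : S.X₁, S.f.hom.hom y = x := by
  have := hS.map (forget₂ (FGModuleCat.{u} A) (ModuleCat.{u} A))
  rw [ShortComplex.moduleCat_exact_iff] at this
  exact this x hx

theorem surjective_of_epi_fgModuleCat {M N : FGModuleCat.{u} A} (f : M ⟶ N) [Epi f] :
    Function.Surjective f.hom.hom :=
  (ModuleCat.epi_iff_surjective _).1
    (inferInstanceAs (Epi ((forget₂ (FGModuleCat.{u} A) (ModuleCat.{u} A)).map f)))

theorem epi_of_surjective_fgModuleCat {M N : FGModuleCat.{u} A} (f : M ⟶ N)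
    (hf : Function.Surjective f.hom.hom) : Epi f :=
  (forget₂ (FGModuleCat.{u} A) (ModuleCat.{u} A)).epi_of_epi_map
    ((ModuleCat.epi_iff_surjective _).2 hf)

/-- In a complex whose incoming differential at `i` is radical, `dim X^i` is bounded in terms of
`dim H^i` and `dim X^{i+1}`. -/
theorem dimOver_X_le (k : Type v) [Field k] [Algebra k A] [Module.Finite k A]
    (X : CochainComplex (FGModuleCat.{u} A) ℤ) (i : ℤ)
    (hX : LinearMap.range (X.d (i - 1) i).hom.hom ≤ Module.jacobson A (X.X i)) :
    dimOver k (X.X i) ≤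
      (dimOver k (X.homology i) + dimOver k (X.X (i + 1))) * Module.finrank k A := by
  -- The kernel of X^i → X^i / im d is the radical image of d; the quotient X^i / im d is in turn an
  -- extension of a submodule of X^{i+1} by H^i.
  have h1 : dimOver k (X.X i) ≤ dimOver k (X.opcycles i) * Module.finrank k A := by
    refine dimOver_le_of_le_jacobson k (X.pOpcycles i).hom.hom fun x hx => hX ?_
    have hS := ShortComplex.exact_of_g_is_cokernel
      (ShortComplex.mk (X.d (i - 1) i) (X.pOpcycles i) (by simp))
      (X.opcyclesIsCokernel (i - 1) i (by simp))
    exact exact_iff_fgModuleCat hS x hx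
  have h2 : dimOver k (X.opcycles i) ≤ dimOver k (X.homology i) + dimOver k (X.X (i + 1)) := by
    have hS := ShortComplex.exact_of_f_is_kernel
      (ShortComplex.mk (X.homologyι i) (X.fromOpcycles i (i + 1)) (by simp))
      (X.homologyIsKernel i (i + 1) (by simp))
    exact dimOver_le_add k _ _ (exact_iff_fgModuleCat hS)
  exact h1.trans (Nat.mul_le_mul_right _ h2)

end Homology

/-! ### Complexes of projective modules -/

section Complexes

variable {A : Type u} [Ring A]

/-- The linear map underlying a morphism of projective modules. -/
abbrev lin {M N : ProjCat A} (f : M ⟶ N) : M.obj →ₗ[A] N.obj := f.hom.hom.hom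

/-- A linear map, as a morphism of projective modules. -/
def ofLin {M N : ProjCat A} (f : M.obj →ₗ[A] N.obj) : M ⟶ N :=
  ObjectProperty.homMk (ObjectProperty.homMk (ModuleCat.ofHom f))

theorem proj_hom_ext {M N : ProjCat A} {f g : M ⟶ N} (h : ∀ x, lin f x = lin g x) : f = g := by
  ext x
  exact h x

theorem lin_comp_apply {M N P : ProjCat A} (f : M ⟶ N) (g : N ⟶ P) (x : M.obj) :
    lin (f ≫ g) x = lin g (lin f x) := rfl

theorem lin_id_apply {M : ProjCat A} (x : M.obj) : lin (𝟙 M) x = x := rfl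

theorem isIso_of_bijective {M N : ProjCat A} (f : M ⟶ N) (hf : Function.Bijective (lin f)) :
    IsIso f :=
  ⟨ofLin (LinearEquiv.ofBijective (lin f) hf).symm.toLinearMap,
    proj_hom_ext fun x => (LinearEquiv.ofBijective (lin f) hf).symm_apply_apply x,
    proj_hom_ext fun x => (LinearEquiv.ofBijective (lin f) hf).apply_symm_apply x⟩

theorem surjective_of_isIso {M N : ProjCat A} (f : M ⟶ N) [IsIso f] :
    Function.Surjective (lin f) := fun x =>
  ⟨lin (inv f) x, by rw [← lin_comp_apply, IsIso.inv_hom_id, lin_id_apply]⟩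

theorem injective_of_comp_eq_id {M N : ProjCat A} {f : M ⟶ N} {g : N ⟶ M} (h : f ≫ g = 𝟙 M) :
    Function.Injective (lin f) := fun x y hxy => by
  have := congrArg (lin g) hxy
  rwa [← lin_comp_apply, ← lin_comp_apply, h] at this

theorem isZero_proj_iff {M : ProjCat A} : IsZero M ↔ IsZero M.obj := by
  refine ⟨fun h => (isProj A).ι.map_isZero h, fun h => ?_⟩
  rw [IsZero.iff_id_eq_zero]
  ext1
  exact h.eq_of_src _ _

instance [IsNoetherianRing A] : IsIdempotentComplete (ProjCat A) := by
  have := Idempotents.isIdempotentComplete_of_abelian (FGModuleCat.{u} A)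
  refine isIdempotentComplete_fullSubcategory (isProj A) fun X Y i p hip hX => ?_
  have : Module.Projective A X := hX
  exact Module.Projective.of_split (M := X) i.hom.hom p.hom.hom
    (congrArg (fun f : Y ⟶ Y => f.hom.hom) hip)

theorem lin_pow_f {X : CochainComplex (ProjCat A) ℤ} (e : End X) (n : ℕ) (i : ℤ) :
    lin (HomologicalComplex.Hom.f (e ^ n : End X) i) =
      (lin (e.f i) : Module.End A (X.X i).obj) ^ n := by
  induction n with
  | zero => rfl
  | succ n ih =>
    rw [pow_succ', pow_succ', ← ih]
    rfl

/-- Powers of an endomorphism of a bounded complex of finitely generated projective modules are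
eventually group-invertible. -/
theorem exists_groupInverse_complex (k : Type v) [Field k] [Algebra k A] [Module.Finite k A]
    {X : CochainComplex (ProjCat A) ℤ} {m : ℕ} (hX : ∀ i : ℤ, i < 0 ∨ (m : ℤ) < i → IsZero (X.X i))
    (e : End X) : ∃ (n : ℕ) (f u : X ⟶ X), f = (e ^ (n + 1) : End X) ∧
      u ≫ f = f ≫ u ∧ u ≫ f ≫ u = u ∧ f ≫ u ≫ f = f := by
  choose n₀ hn₀ using fun i : ℤ => exists_groupInverse k (lin (e.f i) : Module.End A (X.X i).obj)
  -- One exponent beyond the thresholds of all degrees 0, …, m. Using n + 1 keeps it nonzero, so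
  -- that invertibility of the power gives invertibility of e.
  let n := (Finset.Icc (0 : ℤ) m).sup n₀
  have key : ∀ i : ℤ, ∃ ψ : X.X i ⟶ X.X i,
      (HomologicalComplex.Hom.f (e ^ (n + 1) : End X) i) ≫ ψ =
        ψ ≫ (HomologicalComplex.Hom.f (e ^ (n + 1) : End X) i) ∧
      ψ ≫ (HomologicalComplex.Hom.f (e ^ (n + 1) : End X) i) ≫ ψ = ψ ∧
      (HomologicalComplex.Hom.f (e ^ (n + 1) : End X) i) ≫ ψ ≫
        (HomologicalComplex.Hom.f (e ^ (n + 1) : End X) i) =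
        (HomologicalComplex.Hom.f (e ^ (n + 1) : End X) i) := by
    intro i
    by_cases hi : i ∈ Finset.Icc (0 : ℤ) m
    · obtain ⟨ψ, h1, h2, h3⟩ := hn₀ i (n + 1) ((Finset.le_sup (f := n₀) hi).trans n.le_succ)
      rw [← lin_pow_f] at h1 h2 h3
      exact ⟨ofLin ψ, proj_hom_ext fun x => LinearMap.congr_fun h1 x,
        proj_hom_ext fun x => LinearMap.congr_fun h2 x,
        proj_hom_ext fun x => LinearMap.congr_fun h3 x⟩
    · have hz := hX i (by simp only [Finset.mem_Icc] at hi; omega)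
      exact ⟨0, hz.eq_of_src _ _, hz.eq_of_src _ _, hz.eq_of_src _ _⟩
  choose ψ h1 h2 h3 using key
  let f : X ⟶ X := (e ^ (n + 1) : End X)
  refine ⟨n, f, ⟨ψ, fun i j _ => ?_⟩, rfl, ?_, ?_, ?_⟩
  · exact groupInverse_natural (f.comm i j) (h1 i).symm (h2 i) (h1 j).symm (h2 j) (h3 i) (h3 j)
  · ext1 i; exact (h1 i).symm
  · ext1 i; exact h2 i
  · ext1 i; exact h3 i

/-- An endomorphism of a bounded complex of finitely generated projective modules without
nontrivial idempotents is nilpotent or invertible. -/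
theorem nilpotent_or_isIso (k : Type v) [Field k] [Algebra k A] [Module.Finite k A]
    {X : CochainComplex (ProjCat A) ℤ} {m : ℕ} (hX : ∀ i : ℤ, i < 0 ∨ (m : ℤ) < i → IsZero (X.X i))
    (hid : ∀ q : X ⟶ X, q ≫ q = q → q = 0 ∨ q = 𝟙 X) (e : End X) :
    IsNilpotent e ∨ IsUnit e := by
  obtain ⟨n, f, u, hf, h1, h2, h3⟩ := exists_groupInverse_complex k hX e
  -- The idempotent `f ≫ u` is the Fitting projection: if it is 0 then f = fuf = 0, if it is 1 then
  -- f is invertible.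
  rcases hid (f ≫ u) (by rw [Category.assoc, h2]) with h | h
  · left
    refine ⟨n + 1, hf.symm.trans ?_⟩
    rw [← h3, ← Category.assoc, h, zero_comp]
  · right
    rw [← isUnit_pow_iff n.succ_ne_zero, Nat.succ_eq_add_one, isUnit_iff_isIso]
    rw [← hf]
    exact ⟨u, h, h1.trans h⟩

/-! ### Homotopy minimal complexes -/

theorem IsHomotopyMinimal.d_mem {X : CochainComplex (ProjCat A) ℤ} (hX : IsHomotopyMinimal X)
    (i j : ℤ) (x : (X.X i).obj) : lin (X.d i j) x ∈ Module.jacobson A (X.X j).obj := by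
  by_cases h : i + 1 = j
  · subst h
    exact hX i ⟨x, rfl⟩
  · rw [X.shape i j h]
    exact Submodule.zero_mem _

theorem lin_mem_jacobson {M N : ProjCat A} (f : M ⟶ N) {x : M.obj}
    (hx : x ∈ Module.jacobson A M.obj) : lin f x ∈ Module.jacobson A N.obj :=
  Module.map_jacobson_le (lin f) (Submodule.mem_map_of_mem hx)

theorem IsHomotopyMinimal.of_retract {X Y : CochainComplex (ProjCat A) ℤ}
    (hX : IsHomotopyMinimal X) (i : Y ⟶ X) (p : X ⟶ Y) (hip : i ≫ p = 𝟙 Y) :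
    IsHomotopyMinimal Y := by
  rintro j _ ⟨x, rfl⟩
  have h : Y.d j (j + 1) = i.f j ≫ X.d j (j + 1) ≫ p.f (j + 1) := by
    rw [← p.comm, ← Category.assoc, ← HomologicalComplex.comp_f, hip, HomologicalComplex.id_f,
      Category.id_comp]
  change lin (Y.d j (j + 1)) x ∈ _
  rw [h]
  exact lin_mem_jacobson (p.f (j + 1)) (hX.d_mem j (j + 1) (lin (i.f j) x))

/-- An endomorphism of a homotopy minimal complex which is homotopic to the identity is an
isomorphism. -/
theorem IsHomotopyMinimal.isIso_of_homotopy [IsNoetherianRing A]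
    {X : CochainComplex (ProjCat A) ℤ} (hX : IsHomotopyMinimal X) {f : X ⟶ X}
    (h : Homotopy f (𝟙 X)) : IsIso f := by
  have : ∀ i, IsIso (f.f i) := by
    intro i
    have hs : Function.Surjective (lin (f.f i)) := by
      -- In each degree f - 1 = dh + hd has radical image because d does, so f is surjective by
      -- Nakayama; a surjective endomorphism of a Noetherian module is injective.
      rw [← LinearMap.range_eq_top]
      apply eq_top_of_sup_jacobson
      rw [eq_top_iff]
      intro x _
      have hc := h.comm i
      rw [dNext_eq h.hom (show (ComplexShape.up ℤ).Rel i (i + 1) by simp),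
        prevD_eq h.hom (show (ComplexShape.up ℤ).Rel (i - 1) i by simp)] at hc
      have hx : lin (f.f i) x = lin (h.hom (i + 1) i) (lin (X.d i (i + 1)) x) +
          lin (X.d (i - 1) i) (lin (h.hom i (i - 1)) x) + x := by
        rw [hc]; rfl
      have h1 : lin (h.hom (i + 1) i) (lin (X.d i (i + 1)) x) +
          lin (X.d (i - 1) i) (lin (h.hom i (i - 1)) x) ∈ Module.jacobson A (X.X i).obj :=
        Submodule.add_mem _ (lin_mem_jacobson _ (hX.d_mem _ _ _)) (hX.d_mem _ _ _)
      have h2 : lin (f.f i) x ∈ LinearMap.range (lin (f.f i)) := ⟨x, rfl⟩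
      have := Submodule.add_mem_sup h2 (Submodule.neg_mem _ h1)
      rwa [hx, add_assoc, add_comm x, add_neg_cancel_left] at this
    exact isIso_of_bijective _
      ⟨IsNoetherian.injective_of_surjective_endomorphism _ hs, hs⟩
  exact HomologicalComplex.Hom.isIso_of_components f

/-- Homotopy equivalent homotopy minimal complexes are isomorphic. -/
theorem IsHomotopyMinimal.nonempty_iso [IsNoetherianRing A]
    {X Y : CochainComplex (ProjCat A) ℤ} (hX : IsHomotopyMinimal X) (hY : IsHomotopyMinimal Y)
    (e : HomotopyEquiv X Y) : Nonempty (X ≅ Y) := by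
  have h1 := hX.isIso_of_homotopy e.homotopyHomInvId
  have h2 := hY.isIso_of_homotopy e.homotopyInvHomId
  have : IsSplitMono e.hom := ⟨⟨e.inv ≫ inv (e.hom ≫ e.inv), by
    rw [← Category.assoc, IsIso.hom_inv_id]⟩⟩
  have : IsSplitEpi e.hom := ⟨⟨inv (e.inv ≫ e.hom) ≫ e.inv, by
    rw [Category.assoc, IsIso.inv_hom_id]⟩⟩
  have := isIso_of_mono_of_isSplitEpi e.hom
  exact ⟨asIso e.hom⟩

instance [IsNoetherianRing A] (m : ℕ) : IsIdempotentComplete (Cm A m) :=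
  isIdempotentComplete_fullSubcategory (isCm A m) fun _ _ i p hip hX =>
    ⟨hX.1.of_retract i p hip, fun j hj => by
      rw [IsZero.iff_id_eq_zero, ← HomologicalComplex.id_f, ← hip, HomologicalComplex.comp_f,
        (hX.2 j hj).eq_of_tgt (i.f j) 0, zero_comp]⟩

end Complexes

/-! ### Total dimension -/

section TotalDimension

variable (k : Type v) [Field k] {A : Type u} [Ring A] [Algebra k A]

/-- The total dimension of a complex in degrees `0, …, m`. -/
noncomputable def totalDim (m : ℕ) (X : CochainComplex (ProjCat A) ℤ) : ℕ :=
  ∑ i ∈ Finset.Icc (0 : ℤ) m, dimOver k (X.X i).obj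

variable [Module.Finite k A]

/-- Total dimension is additive on biproducts and vanishes only on zero complexes, so it serves as a
size function. -/
theorem finiteUpTo_totalDim_le {m : ℕ} (h : CmFiniteType A m) (N : ℕ) :
    FiniteUpTo Isomorphic fun X : Cm A m => totalDim k m X.obj ≤ N := by
  refine finiteUpTo_of_size_le (fun X : Cm A m => totalDim k m X.obj) ?_ ?_ ?_ h N
  · intro X hX
    rw [IsZero.iff_id_eq_zero]
    ext1
    ext1 i
    refine IsZero.eq_of_src ?_ _ _
    by_cases hi : i ∈ Finset.Icc (0 : ℤ) m
    · exact isZero_proj_iff.2 (isZero_of_dimOver_eq_zero k (Finset.sum_eq_zero_iff.1 hX i hi))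
    · exact X.property.2 i (by simp only [Finset.mem_Icc] at hi; omega)
  · intro Y Z b hb
    simp only [totalDim, ← Finset.sum_add_distrib]
    refine Finset.sum_congr rfl fun i _ => ?_
    let G : Cm A m ⥤ FGModuleCat A := (isCm A m).ι ⋙ HomologicalComplex.eval _ _ i ⋙ (isProj A).ι
    refine dimOver_biprod k (G.mapBinaryBicone b) (isBinaryBilimitOfTotal _ ?_)
    change G.map b.fst ≫ G.map b.inl + G.map b.snd ≫ G.map b.inr = 𝟙 (G.obj b.pt)
    rw [← G.map_comp, ← G.map_comp, ← G.map_add, IsBilimit.binary_total hb, G.map_id]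
  · rintro X Y ⟨e⟩
    refine Finset.sum_congr rfl fun i _ => ?_
    let G : Cm A m ⥤ FGModuleCat A := (isCm A m).ι ⋙ HomologicalComplex.eval _ _ i ⋙ (isProj A).ι
    exact dimOver_eq_of_iso k (G.mapIso e)

end TotalDimension

/-! ### Projective objects in the category of finitely generated modules -/

section Projective

variable {A : Type u} [Ring A] [IsNoetherianRing A]

theorem projective_of_module_projective (M : FGModuleCat.{u} A) [Module.Projective A M] :
    Projective M where
  factors {E X} f e he := by
    obtain ⟨h, hh⟩ := Module.projective_lifting_property e.hom.hom f.hom.hom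
      (surjective_of_epi_fgModuleCat e)
    exact ⟨ObjectProperty.homMk (ModuleCat.ofHom h), by ext x; exact LinearMap.congr_fun hh x⟩

instance (M : ProjCat A) : Projective ((isProj A).ι.obj M) :=
  have : Module.Projective A M.obj := M.property
  projective_of_module_projective M.obj

theorem exists_free_cover (M : FGModuleCat.{u} A) :
    ∃ (F : FGModuleCat.{u} A) (_ : Module.Projective A F) (f : F ⟶ M), Epi f := by
  obtain ⟨n, f, hf⟩ := Module.Finite.exists_fin' A M
  exact ⟨FGModuleCat.of A (Fin n → A), inferInstanceAs (Module.Projective A (Fin n → A)),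
    ObjectProperty.homMk (ModuleCat.ofHom f), epi_of_surjective_fgModuleCat _ hf⟩

instance : EnoughProjectives (FGModuleCat.{u} A) where
  presentation M := by
    obtain ⟨F, _, f, _⟩ := exists_free_cover M
    have := projective_of_module_projective F
    exact ⟨{ p := F, f := f }⟩

/-- A categorically projective M is a direct summand of a projective module covering it. -/
theorem module_projective_of_projective (M : FGModuleCat.{u} A) [Projective M] :
    Module.Projective A M := by
  obtain ⟨F, _, f, _⟩ := exists_free_cover M
  let s := Projective.factorThru (𝟙 M) f
  exact Module.Projective.of_split (M := F) s.hom.hom f.hom.hom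
    (congrArg (fun g : M ⟶ M => g.hom.hom) (Projective.factorThru_comp (𝟙 M) f))

end Projective

/-! ### Projective resolutions of complexes -/

section Resolution

variable {C : Type*} [Category C] [Abelian C]

theorem quasiIso_of_opEquivalence {K L : CochainComplex C ℤ} (f : K ⟶ L)
    (hf : QuasiIso ((CochainComplex.opEquivalence C).functor.map f.op)) : QuasiIso f where
  quasiIsoAt n := by
    obtain ⟨n, rfl⟩ : ∃ n', n = -n' := ⟨-n, by simp⟩
    have h := hf.quasiIsoAt n
    rw [quasiIsoAt_iff' _ (n - 1) n (n + 1) (by simp) (by simp)] at h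
    rw [quasiIsoAt_iff' _ (-(n + 1)) (-n) (-(n - 1)) (by simp; omega) (by simp; omega),
      ← ShortComplex.quasiIso_opMap_iff]
    exact h

/-- Dual of the existence of injective resolutions of bounded below complexes, applied in the
opposite category. -/
theorem exists_projective_quasiIso [EnoughProjectives C] (K : CochainComplex C ℤ) (m : ℤ)
    [K.IsStrictlyLE m] : ∃ (P : CochainComplex C ℤ) (f : P ⟶ K), QuasiIso f ∧
      (∀ n, Projective (P.X n)) ∧ ∀ n, m < n → IsZero (P.X n) := by
  let E := CochainComplex.opEquivalence C
  let K' := E.functor.obj (Opposite.op K)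
  have : K'.IsStrictlyGE (-m) := by
    rw [CochainComplex.isStrictlyGE_iff]
    intro i hi
    exact (K.isZero_of_isStrictlyLE m (-i) (by omega)).op
  obtain ⟨L, i, hi, hL, hL'⟩ := CochainComplex.Plus.modelCategoryQuillen.exists_quasiIso_injective K' (-m)
  let g : Opposite.op K ⟶ E.inverse.obj L := E.unit.app _ ≫ E.inverse.map i
  refine ⟨(E.inverse.obj L).unop, g.unop, quasiIso_of_opEquivalence _ ?_, fun n => ?_,
    fun n hn => ?_⟩
  · have : E.functor.map g = i ≫ E.counitInv.app L := by
      simp [g]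
    change QuasiIso (E.functor.map g)
    rw [this]
    infer_instance
  · change Projective (L.X (-n)).unop
    infer_instance
  · exact (L.isZero_of_isStrictlyGE (-m) (-n) (by omega)).unop

end Resolution

open scoped ZeroObject

/-! ### Brutal truncation -/

section Truncation

variable {C : Type*} [Category C] [Abelian C]

theorem exists_brutal_truncation (K : CochainComplex C ℤ) (n : ℤ) :
    ∃ (L : CochainComplex C ℤ) (f : L ⟶ K), (∀ i, i < n → IsZero (L.X i)) ∧
      ∀ i, n ≤ i → IsIso (f.f i) := by
  have key : ∀ i : ℤ, ∃ (X : C) (f : X ⟶ K.X i) (g : K.X i ⟶ X),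
      (n ≤ i → f ≫ g = 𝟙 X ∧ g ≫ f = 𝟙 (K.X i)) ∧ (i < n → IsZero X) := by
    intro i
    by_cases hi : n ≤ i
    · exact ⟨K.X i, 𝟙 _, 𝟙 _, by simp, by omega⟩
    · exact ⟨0, 0, 0, fun h => absurd h hi, fun _ => isZero_zero C⟩
  choose X f g h1 h2 using key
  refine ⟨{ X := X, d := fun i j => f i ≫ K.d i j ≫ g j, shape := ?_, d_comp_d' := ?_ },
    ⟨f, ?_⟩, h2, fun i hi => ⟨g i, h1 i hi⟩⟩
  · intro i j hij
    rw [K.shape i j hij, zero_comp, comp_zero]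
  · intro i j l _ _
    by_cases hj : n ≤ j
    · simp only [Category.assoc]
      rw [reassoc_of% (h1 j hj).2, K.d_comp_d_assoc, zero_comp, comp_zero]
    · rw [(h2 j (by omega)).eq_of_tgt (f i ≫ K.d i j ≫ g j) 0, zero_comp]
  · intro i j hij
    by_cases hj : n ≤ j
    · simp only [Category.assoc]
      rw [(h1 j hj).2, Category.comp_id]
    · have hij : i + 1 = j := hij
      exact (h2 i (by omega)).eq_of_src _ _

/-- H^i depends only on degrees i - 1, i and i + 1, so a brutal truncation at n preserves it for i >
n. -/
theorem quasiIsoAt_of_isIso {K L : CochainComplex C ℤ} (f : K ⟶ L) (i : ℤ)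
    (h0 : IsIso (f.f (i - 1))) (h1 : IsIso (f.f i)) (h2 : IsIso (f.f (i + 1))) :
    QuasiIsoAt f i := by
  rw [quasiIsoAt_iff' f (i - 1) i (i + 1) (by simp) (by simp)]
  have : Epi ((HomologicalComplex.shortComplexFunctor' C (ComplexShape.up ℤ) (i - 1) i
    (i + 1)).map f).τ₁ := inferInstanceAs (Epi (f.f (i - 1)))
  have : IsIso ((HomologicalComplex.shortComplexFunctor' C (ComplexShape.up ℤ) (i - 1) i
    (i + 1)).map f).τ₂ := h1
  have : Mono ((HomologicalComplex.shortComplexFunctor' C (ComplexShape.up ℤ) (i - 1) i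
    (i + 1)).map f).τ₃ := inferInstanceAs (Mono (f.f (i + 1)))
  exact ShortComplex.quasiIso_of_epi_of_isIso_of_mono _

variable [HasDerivedCategory C]

theorem isIso_homology_Q_map {K L : CochainComplex C ℤ} (f : K ⟶ L) (i : ℤ) :
    IsIso ((DerivedCategory.homologyFunctor C i).map (DerivedCategory.Q.map f)) ↔
      QuasiIsoAt f i := by
  rw [quasiIsoAt_iff_isIso_homologyMap]
  exact NatIso.isIso_map_iff (DerivedCategory.homologyFunctorFactors C i) f

/-- A morphism inducing isomorphisms on cohomology in degrees `≥ 1` is a universal map to objects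
with cohomology in degrees `≥ 1`. -/
theorem exists_factorization {Y X X' : DerivedCategory C} (φ : Y ⟶ X)
    (hφ : ∀ i : ℤ, 1 ≤ i → IsIso ((DerivedCategory.homologyFunctor C i).map φ))
    (hX : X.IsGE 1) (hX' : X'.IsGE 1) (f : Y ⟶ X') : ∃ g : X ⟶ X', φ ≫ g = f := by
  obtain ⟨Z, ψ, w, hT⟩ := Pretriangulated.distinguished_cocone_triangle₁ φ
  have hZ : Z.IsLE 0 := by
    rw [DerivedCategory.isLE_iff]
    intro i hi
    have h1 : (DerivedCategory.homologyFunctor C i).map ψ = 0 := by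
      have := hφ i (by omega)
      rw [← cancel_mono ((DerivedCategory.homologyFunctor C i).map φ), zero_comp,
        ← Functor.map_comp]
      have h := Pretriangulated.comp_distTriang_mor_zero₁₂ _ hT
      exact (congrArg _ h).trans (Functor.map_zero _ _ _)
    have h2 : DerivedCategory.HomologySequence.δ _ (i - 1) i (by omega) = 0 :=
      (DerivedCategory.HomologySequence.epi_homologyMap_mor₂_iff _ hT (i - 1) i (by omega)).1 (by
        change Epi ((DerivedCategory.homologyFunctor C (i - 1)).map φ)
        -- For i = 1 the hypothesis on φ says nothing in degree 0, but there H^0(X) = 0.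
        by_cases h : 1 ≤ i - 1
        · have := hφ (i - 1) h
          infer_instance
        · exact ⟨fun a b _ => (X.isZero_of_isGE 1 (i - 1) (by omega)).eq_of_src a b⟩)
    exact (DerivedCategory.HomologySequence.exact₁ _ hT (i - 1) i (by omega)).isZero_of_both_zeros
      h2 h1
  have h0 : ψ ≫ f = 0 :=
    -- The fibre Z of φ lies in degrees ≤ 0 and X' in degrees ≥ 1, so Hom(Z, X') = 0 and f extends
    -- along φ.
    DerivedCategory.TStructure.t.zero_of_isLE_of_isGE _ 0 1 (by omega) hZ hX'
  obtain ⟨g, hg⟩ := Pretriangulated.Triangle.yoneda_exact₂ _ hT f h0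
  exact ⟨g, hg.symm⟩

/-- Both targets are the canonical truncation τ^{≥1}Y. This is how an object is recovered from its
approximation. -/
theorem nonempty_iso_of_approximation {Y X X' : DerivedCategory C} (φ : Y ⟶ X) (φ' : Y ⟶ X')
    (hφ : ∀ i : ℤ, 1 ≤ i → IsIso ((DerivedCategory.homologyFunctor C i).map φ))
    (hφ' : ∀ i : ℤ, 1 ≤ i → IsIso ((DerivedCategory.homologyFunctor C i).map φ'))
    (hX : X.IsGE 1) (hX' : X'.IsGE 1) : Nonempty (X ≅ X') := by
  obtain ⟨g, hg⟩ := exists_factorization φ hφ hX hX' φ'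
  have : IsIso g := by
    rw [DerivedCategory.isIso_iff]
    intro i
    by_cases hi : 1 ≤ i
    · have := hφ i hi
      have := hφ' i hi
      rw [← hg, Functor.map_comp] at this
      exact IsIso.of_isIso_comp_left ((DerivedCategory.homologyFunctor C i).map φ) _
    · exact ⟨0, (X.isZero_of_isGE 1 i (by omega)).eq_of_src _ _,
        (X'.isZero_of_isGE 1 i (by omega)).eq_of_src _ _⟩
  exact ⟨asIso g⟩

end Truncation

/-! ### From the homotopy category of projectives to the derived category -/

section Comparison

variable {A : Type u} [Ring A] [IsNoetherianRing A]

/-- A complex of projective modules, viewed as a complex of modules. -/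
abbrev toModCpx (X : CochainComplex (ProjCat A) ℤ) : CochainComplex (FGModuleCat.{u} A) ℤ :=
  ((isProj A).ι.mapHomologicalComplex (ComplexShape.up ℤ)).obj X

variable (A) in
/-- The functor from the homotopy category of projectives to the derived category. -/
noncomputable abbrev toDerived :
    HomotopyCategory (ProjCat A) (ComplexShape.up ℤ) ⥤ DerivedCategory (FGModuleCat.{u} A) :=
  (isProj A).ι.mapHomotopyCategory _ ⋙ DerivedCategory.Qh

/-- The image in the derived category of a complex of projectives. -/
noncomputable abbrev cpxToDerived (X : CochainComplex (ProjCat A) ℤ) :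
    DerivedCategory (FGModuleCat.{u} A) :=
  (toDerived A).obj ((HomotopyCategory.quotient _ _).obj X)

/-- The image of a complex in the derived category can be computed with the localization functor
on complexes. -/
noncomputable def cpxToDerivedIso (X : CochainComplex (ProjCat A) ℤ) :
    cpxToDerived X ≅ DerivedCategory.Q.obj (toModCpx X) :=
  (DerivedCategory.quotientCompQhIso _).app (toModCpx X)

theorem isKProjective_toModCpx {X : CochainComplex (ProjCat A) ℤ} (hX : IsBoundedComplex X) :
    (toModCpx X).IsKProjective := by
  obtain ⟨a, b, hab⟩ := hX
  have : (toModCpx X).IsStrictlyLE b := by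
    rw [CochainComplex.isStrictlyLE_iff]
    exact fun i hi => (isProj A).ι.map_isZero (hab i (Or.inr hi))
  have : ∀ n, Projective ((toModCpx X).X n) := fun n =>
    inferInstanceAs (Projective ((isProj A).ι.obj (X.X n)))
  exact CochainComplex.isKProjective_of_projective _ b

/-- A bounded complex of projectives is K-projective, so maps out of it in the derived category are
homotopy classes; and A-proj is full in A-mod. Only the source needs to be bounded. -/
theorem toDerived_map_bijective {X : HomotopyCategory (ProjCat A) (ComplexShape.up ℤ)}
    (hX : IsBoundedComplex X.as) (Y : HomotopyCategory (ProjCat A) (ComplexShape.up ℤ)) :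
    Function.Bijective ((toDerived A).map : (X ⟶ Y) → _) := by
  have := isKProjective_toModCpx hX
  have h1 : Function.Bijective
      (((isProj A).ι.mapHomotopyCategory (ComplexShape.up ℤ)).map : (X ⟶ Y) → _) :=
    ⟨Functor.map_injective _, Functor.map_surjective _⟩
  have h2 := CochainComplex.IsKProjective.Qh_map_bijective (toModCpx X.as)
    (((isProj A).ι.mapHomotopyCategory (ComplexShape.up ℤ)).obj Y)
  exact h2.comp h1

theorem nonempty_iso_of_toDerived {X Y : HomotopyCategory (ProjCat A) (ComplexShape.up ℤ)}
    (hX : IsBoundedComplex X.as) (hY : IsBoundedComplex Y.as)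
    (e : (toDerived A).obj X ≅ (toDerived A).obj Y) : Nonempty (X ≅ Y) := by
  obtain ⟨f, hf⟩ := (toDerived_map_bijective hX Y).2 e.hom
  obtain ⟨g, hg⟩ := (toDerived_map_bijective hY X).2 e.inv
  refine ⟨⟨f, g, (toDerived_map_bijective hX X).1 ?_, (toDerived_map_bijective hY Y).1 ?_⟩⟩
  · rw [Functor.map_comp, hf, hg, e.hom_inv_id, CategoryTheory.Functor.map_id]
  · rw [Functor.map_comp, hf, hg, e.inv_hom_id, CategoryTheory.Functor.map_id]

/-- An object of the derived category with cohomology in degrees `≤ m` is approximated by a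
complex of projectives in degrees `0, …, m`. -/
theorem exists_projective_approximation (X : DerivedCategory (FGModuleCat.{u} A)) (m : ℕ)
    [X.IsLE m] : ∃ P : CochainComplex (ProjCat A) ℤ,
      (∀ i : ℤ, i < 0 ∨ (m : ℤ) < i → IsZero (P.X i)) ∧
      ∃ φ : cpxToDerived P ⟶ X,
        ∀ i : ℤ, 1 ≤ i → IsIso ((DerivedCategory.homologyFunctor _ i).map φ) := by
  obtain ⟨K, hK, ⟨e⟩⟩ := DerivedCategory.exists_iso_Q_obj_of_isLE X m
  obtain ⟨P, f, hf, hP, hP'⟩ := exists_projective_quasiIso K m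
  obtain ⟨L, g, hL, hg⟩ := exists_brutal_truncation P 0
  have hz : ∀ i : ℤ, i < 0 ∨ (m : ℤ) < i → IsZero (L.X i) := by
    rintro i (hi | hi)
    · exact hL i hi
    · by_cases h0 : i < 0
      · exact hL i h0
      · have := hg i (by omega)
        exact (hP' i hi).of_iso (asIso (g.f i))
  have hproj : ∀ i : ℤ, isProj A (L.X i) := by
    intro i
    have : Projective (L.X i) := by
      by_cases hi : i < 0
      · exact ⟨fun f e _ => ⟨0, (hL i hi).eq_of_src _ _⟩⟩
      · have := hg i (by omega)
        exact Projective.of_iso (asIso (g.f i)).symm (hP i)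
    exact module_projective_of_projective _
  let M : CochainComplex (ProjCat A) ℤ := HomologicalComplex.liftObjectProperty (isProj A) L hproj
  refine ⟨M, fun i hi => isZero_proj_iff.2 (hz i hi), ?_⟩
  let g' : toModCpx M ⟶ P := g
  refine ⟨(cpxToDerivedIso M).hom ≫
    DerivedCategory.Q.map (g' ≫ f) ≫ e.inv, fun i hi => ?_⟩
  -- Truncation at 0 changes H^0; for i ≥ 1 the degrees i - 1, i, i + 1 are all untouched.
  have h1 : QuasiIsoAt g i :=
    quasiIsoAt_of_isIso g i (hg _ (by omega)) (hg _ (by omega)) (hg _ (by omega))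
  have h2 : QuasiIsoAt (g' ≫ f) i := quasiIsoAt_comp g f i
  have := (isIso_homology_Q_map (g' ≫ f) i).2 h2
  rw [(DerivedCategory.homologyFunctor _ i).map_comp, (DerivedCategory.homologyFunctor _ i).map_comp]
  infer_instance

end Comparison

/-! ### Cohomology dimensions in the derived category -/

section CohomologyDimension

variable (k : Type v) [Field k] {A : Type u} [Ring A] [Algebra k A] [IsNoetherianRing A]

/-- `i ↦ dim_k H^i(X)` for `X` in the derived category. -/
noncomputable def cohDim (X : DerivedCategory (FGModuleCat.{u} A)) (i : ℤ) : ℕ :=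
  dimOver k ((DerivedCategory.homologyFunctor _ i).obj X)

variable [Module.Finite k A]

theorem cohDim_eq_of_iso {X Y : DerivedCategory (FGModuleCat.{u} A)} (e : X ≅ Y) :
    cohDim k X = cohDim k Y :=
  funext fun _ => dimOver_eq_of_iso k ((DerivedCategory.homologyFunctor _ _).mapIso e)

theorem cohDim_shift (X : DerivedCategory (FGModuleCat.{u} A)) (n i : ℤ) :
    cohDim k ((shiftFunctor _ n).obj X) i = cohDim k X (n + i) :=
  dimOver_eq_of_iso k
    (((DerivedCategory.homologyFunctor (FGModuleCat.{u} A) 0).shiftIso n i (n + i) rfl).app X)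

theorem cohDim_cpxToDerived (X : CochainComplex (ProjCat A) ℤ) (i : ℤ) :
    cohDim k (cpxToDerived X) i = dimOver k ((toModCpx X).homology i) :=
  dimOver_eq_of_iso k ((DerivedCategory.homologyFunctor _ i).mapIso
    (cpxToDerivedIso X) ≪≫
      (DerivedCategory.homologyFunctorFactors _ i).app (toModCpx X))

theorem cohDimCm_eq {m : ℕ} (X : Cm A m) : cohDimCm k X = cohDim k (cpxToDerived X.obj) :=
  funext fun i => (cohDim_cpxToDerived k X.obj i).symm

theorem cohDimKb_eq (X : Kb A) : cohDimKb k X = cohDim k ((toDerived A).obj X.obj) :=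
  funext fun i => dimOver_eq_of_iso k
    ((DerivedCategory.homologyFunctorFactorsh _ i).app _).symm

theorem cohDim_eq_zero_iff (X : DerivedCategory (FGModuleCat.{u} A)) (i : ℤ) :
    cohDim k X i = 0 ↔ IsZero ((DerivedCategory.homologyFunctor _ i).obj X) :=
  dimOver_eq_zero_iff k

end CohomologyDimension

/-! ### Approximations of smallest dimension -/

section Approximation

variable {A : Type u} [Ring A] [IsNoetherianRing A]

/-- The functor from complexes of projectives to modules given by `H^i`. -/
noncomputable abbrev projHomology (i : ℤ) : CochainComplex (ProjCat A) ℤ ⥤ FGModuleCat.{u} A :=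
  HomotopyCategory.quotient _ _ ⋙ toDerived A ⋙ DerivedCategory.homologyFunctor _ i

/-- `P` is a complex of projectives in degrees `0, …, m` with a morphism to `X` that is an
isomorphism on cohomology in degrees `≥ 1`. -/
def IsApproximation (m : ℕ) (P : CochainComplex (ProjCat A) ℤ)
    (X : DerivedCategory (FGModuleCat.{u} A)) : Prop :=
  (∀ i : ℤ, i < 0 ∨ (m : ℤ) < i → IsZero (P.X i)) ∧
    ∃ φ : cpxToDerived P ⟶ X, ∀ i : ℤ, 1 ≤ i →
      IsIso ((DerivedCategory.homologyFunctor _ i).map φ)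

theorem IsApproximation.of_retract {m : ℕ} {P Q : CochainComplex (ProjCat A) ℤ}
    {X : DerivedCategory (FGModuleCat.{u} A)} (hP : IsApproximation m P X) (ι : Q ⟶ P) (p : P ⟶ Q)
    (hιp : ι ≫ p = 𝟙 Q) (h : ∀ i : ℤ, 1 ≤ i → IsIso ((projHomology i).map ι)) :
    IsApproximation m Q X := by
  obtain ⟨hP, φ, hφ⟩ := hP
  refine ⟨fun i hi => ?_, (toDerived A).map ((HomotopyCategory.quotient _ _).map ι) ≫ φ,
    fun i hi => ?_⟩
  · rw [IsZero.iff_id_eq_zero, ← HomologicalComplex.id_f, ← hιp, HomologicalComplex.comp_f,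
      (hP i hi).eq_of_tgt (ι.f i) 0, zero_comp]
  · have h1 := h i hi
    have h2 := hφ i hi
    rw [(DerivedCategory.homologyFunctor _ i).map_comp]
    exact IsIso.comp_isIso' h1 h2

theorem homologyMap_eq_zero {C : Type*} [Category C] [Abelian C] {K L : CochainComplex C ℤ}
    (f : K ⟶ L) (i : ℤ) (hf : f.f i = 0) : HomologicalComplex.homologyMap f i = 0 := by
  have : HomologicalComplex.cyclesMap f i = 0 := by
    rw [← cancel_mono (HomologicalComplex.iCycles _ i), zero_comp,
      HomologicalComplex.cyclesMap_i, hf, comp_zero]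
  rw [← cancel_epi (HomologicalComplex.homologyπ _ i), comp_zero,
    HomologicalComplex.homologyπ_naturality, this, zero_comp]

theorem isIso_map_pow {C D : Type*} [Category C] [Category D] (G : C ⥤ D) {X : C} (e : End X)
    (h : IsIso (G.map e)) (n : ℕ) : IsIso (G.map (e ^ n : End X)) := by
  induction n with
  | zero =>
    change IsIso (G.map (𝟙 X))
    infer_instance
  | succ n ih =>
    rw [pow_succ']
    change IsIso (G.map ((e ^ n : End X) ≫ e))
    rw [G.map_comp]
    infer_instance

variable (k : Type v) [Field k] [Algebra k A] [Module.Finite k A]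

omit [IsNoetherianRing A] in
theorem isIso_of_totalDim_le {m : ℕ} {P Q : CochainComplex (ProjCat A) ℤ}
    (hP : ∀ i : ℤ, i < 0 ∨ (m : ℤ) < i → IsZero (P.X i))
    (hQ : ∀ i : ℤ, i < 0 ∨ (m : ℤ) < i → IsZero (Q.X i)) (ι : Q ⟶ P) (p : P ⟶ Q)
    (hιp : ι ≫ p = 𝟙 Q) (h : totalDim k m P ≤ totalDim k m Q) : IsIso ι := by
  have hinj : ∀ i, Function.Injective (lin (ι.f i)) := fun i =>
    injective_of_comp_eq_id (g := p.f i) (by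
      rw [← HomologicalComplex.comp_f, hιp, HomologicalComplex.id_f])
  have hle : ∀ i ∈ Finset.Icc (0 : ℤ) m, dimOver k (Q.X i).obj ≤ dimOver k (P.X i).obj :=
    fun i _ => dimOver_le_of_injective k _ (hinj i)
  have heq := (Finset.sum_eq_sum_iff_of_le hle).1 (le_antisymm (Finset.sum_le_sum hle) h)
  have : ∀ i, IsIso (ι.f i) := by
    intro i
    by_cases hi : i ∈ Finset.Icc (0 : ℤ) m
    · exact isIso_of_bijective _
        (bijective_of_injective_of_dimOver_le k _ (hinj i) (heq i hi).ge)
    · have hi' : i < 0 ∨ (m : ℤ) < i := by simp only [Finset.mem_Icc] at hi; omega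
      exact ⟨0, (hQ i hi').eq_of_src _ _, (hP i hi').eq_of_src _ _⟩
  exact HomologicalComplex.Hom.isIso_of_components ι

/-- An endomorphism of an approximation of smallest dimension is an isomorphism as soon as it
induces isomorphisms on cohomology in degrees `≥ 1`. -/
theorem isIso_of_minimal_totalDim {m : ℕ} {P : CochainComplex (ProjCat A) ℤ}
    {X : DerivedCategory (FGModuleCat.{u} A)} (hP : IsApproximation m P X)
    (hmin : ∀ Q, IsApproximation m Q X → totalDim k m P ≤ totalDim k m Q) (e : P ⟶ P)
    (he : ∀ i : ℤ, 1 ≤ i → IsIso ((projHomology i).map e)) : IsIso e := by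
  obtain ⟨n, f, u, hf, h1, h2, h3⟩ := exists_groupInverse_complex k hP.1 e
  -- The image Q of the Fitting projection is again an approximation, since the projection acts as
  -- the identity on cohomology in degrees ≥ 1. Minimality forces Q to be all of P, so e is
  -- invertible.
  obtain ⟨Q, ι, p, hιp, hpι⟩ := IsIdempotentComplete.idempotents_split P (f ≫ u)
    (by rw [Category.assoc, h2])
  have hι : ∀ i : ℤ, 1 ≤ i → IsIso ((projHomology i).map ι) := by
    intro i hi
    have hfi : IsIso ((projHomology i).map f) := by
      rw [hf]
      exact isIso_map_pow _ (X := P) e (he i hi) _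
    have hq : (projHomology i).map (f ≫ u) = 𝟙 _ := by
      rw [← h1, ← cancel_epi ((projHomology i).map f), ← (projHomology i).map_comp, h3,
        Category.comp_id]
    refine ⟨(projHomology i).map p, ?_, ?_⟩
    · rw [← (projHomology i).map_comp, hιp, (projHomology i).map_id]
    · rw [← (projHomology i).map_comp, hpι, hq]
  have hQ := hP.of_retract ι p hιp hι
  have := isIso_of_totalDim_le k hP.1 hQ.1 ι p hιp (hmin Q hQ)
  have hfu : f ≫ u = 𝟙 P := by
    rw [← hpι, ← cancel_epi ι, reassoc_of% hιp, Category.comp_id]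
  have hf' : IsIso f := ⟨u, hfu, h1.trans hfu⟩
  have : IsUnit (M := End P) e := by
    rw [← isUnit_pow_iff n.succ_ne_zero, Nat.succ_eq_add_one, isUnit_iff_isIso, ← hf]
    exact hf'
  exact (isUnit_iff_isIso e).1 this

/-- If im d^i is not radical, it supplements some maximal submodule L. Lifting P^{i+1} → P^{i+1}/L
through d^i gives a map h with dh ≡ 1 modulo L. Subtracting from 1 the null-homotopic map built from
h gives an endomorphism homotopic to 1 whose component in degree i + 1 has image in L, contradicting
`isIso_of_minimal_totalDim`. -/
theorem isHomotopyMinimal_of_minimal_totalDim {m : ℕ} {P : CochainComplex (ProjCat A) ℤ}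
    {X : DerivedCategory (FGModuleCat.{u} A)} (hP : IsApproximation m P X)
    (hmin : ∀ Q, IsApproximation m Q X → totalDim k m P ≤ totalDim k m Q) :
    IsHomotopyMinimal P := by
  intro i
  by_contra hi
  obtain ⟨L, hL, hsup⟩ := exists_isCoatom_sup_eq_top hi
  have hsurj : Function.Surjective (L.mkQ ∘ₗ lin (P.d i (i + 1))) := by
    rw [← LinearMap.range_eq_top, LinearMap.range_comp, eq_top_iff]
    rintro x -
    obtain ⟨x, rfl⟩ := L.mkQ_surjective x
    have hx : x ∈ LinearMap.range (lin (P.d i (i + 1))) ⊔ L := by rw [hsup]; trivial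
    obtain ⟨y, hy, z, hz, rfl⟩ := Submodule.mem_sup.1 hx
    refine ⟨y, hy, ?_⟩
    rw [map_add, (L.mkQ_apply z).trans ((Submodule.Quotient.mk_eq_zero L).2 hz), add_zero]
  have : Module.Projective A (P.X (i + 1)).obj := (P.X (i + 1)).property
  obtain ⟨h, hh⟩ := Module.projective_lifting_property _ L.mkQ hsurj
  let h' : P.X (i + 1) ⟶ P.X i := ofLin h
  -- The homotopy is h from degree i + 1 to degree i and zero elsewhere, so in degree i + 1 the map
  -- N is just dh.
  let H : ∀ a b : ℤ, (ComplexShape.up ℤ).Rel b a → (P.X a ⟶ P.X b) := fun a b _ =>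
    if hab : a = i + 1 ∧ b = i then eqToHom (by rw [hab.1]) ≫ h' ≫ eqToHom (by rw [hab.2]) else 0
  let N := Homotopy.nullHomotopicMap' H
  have hN : N.f (i + 1) = h' ≫ P.d i (i + 1) := by
    have := Homotopy.nullHomotopicMap'_f (k₂ := i) (k₁ := i + 1) (k₀ := i + 1 + 1) (by simp)
      (by simp) H
    refine this.trans ?_
    simp [H]
  have hcomp : Homotopy (𝟙 P - N) (𝟙 P) :=
    (Homotopy.equivSubZero.symm ((Homotopy.ofEq (sub_sub_cancel _ N)).trans
      (Homotopy.nullHomotopy' H))).symm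
  have hiso : IsIso (𝟙 P - N) := by
    refine isIso_of_minimal_totalDim k hP hmin _ fun j _ => ?_
    have : (HomotopyCategory.quotient _ _).map (𝟙 P - N) =
      (HomotopyCategory.quotient _ _).map (𝟙 P) := HomotopyCategory.eq_of_homotopy _ _ hcomp
    rw [Functor.comp_map, this, CategoryTheory.Functor.map_id]
    infer_instance
  apply hL.1
  rw [eq_top_iff]
  rintro x -
  obtain ⟨y, rfl⟩ := surjective_of_isIso ((𝟙 P - N).f (i + 1)) x
  have h1 : lin ((𝟙 P - N).f (i + 1)) y = y - lin (P.d i (i + 1)) (h y) := by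
    rw [HomologicalComplex.sub_f_apply, hN]; rfl
  have h2 : L.mkQ (lin (P.d i (i + 1)) (h y)) = L.mkQ y := LinearMap.congr_fun hh y
  rw [h1, ← Submodule.Quotient.mk_eq_zero, ← Submodule.mkQ_apply, map_sub, h2, sub_self]

/-- If ker d^0 supplements a maximal submodule L, then d^0 and its restriction to L have the same
image, and projectivity yields an endomorphism g of P^0 into L with d^0 g = d^0. Replacing the
identity by g in degree 0 gives a chain map that is the identity on H^i for i ≥ 1, so it would be an
isomorphism although g misses part of P^0. -/
theorem ker_le_jacobson_of_minimal_totalDim {m : ℕ} {P : CochainComplex (ProjCat A) ℤ}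
    {X : DerivedCategory (FGModuleCat.{u} A)} (hP : IsApproximation m P X)
    (hmin : ∀ Q, IsApproximation m Q X → totalDim k m P ≤ totalDim k m Q) :
    LinearMap.ker (lin (P.d 0 1)) ≤ Module.jacobson A (P.X 0).obj := by
  by_contra hi
  obtain ⟨L, hL, hsup⟩ := exists_isCoatom_sup_eq_top hi
  have hsurj : Function.Surjective ((lin (P.d 0 1)).rangeRestrict ∘ₗ L.subtype) := by
    rintro ⟨_, x, rfl⟩
    have hx : x ∈ LinearMap.ker (lin (P.d 0 1)) ⊔ L := by rw [hsup]; trivial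
    obtain ⟨y, hy, z, hz, rfl⟩ := Submodule.mem_sup.1 hx
    refine ⟨⟨z, hz⟩, Subtype.ext ?_⟩
    change lin (P.d 0 1) z = lin (P.d 0 1) (y + z)
    rw [map_add, LinearMap.mem_ker.1 hy, zero_add]
  have : Module.Projective A (P.X 0).obj := (P.X 0).property
  obtain ⟨g, hg⟩ := Module.projective_lifting_property _ (lin (P.d 0 1)).rangeRestrict hsurj
  let g' : P.X 0 ⟶ P.X 0 := ofLin (L.subtype ∘ₗ g)
  have hg' : g' ≫ P.d 0 1 = P.d 0 1 := proj_hom_ext fun x =>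
    congrArg Subtype.val (LinearMap.congr_fun hg x)
  let N : P ⟶ P :=
    { f := fun i => if hi : i = 0 then eqToHom (by rw [hi]) ≫ (g' - 𝟙 _) ≫ eqToHom (by rw [hi])
        else 0
      comm' := by
        intro i j hij
        have hij : i + 1 = j := hij
        by_cases hi : i = 0
        · subst hi
          obtain rfl : j = 1 := by omega
          simp [hg']
        · by_cases hj : j = 0
          · exact (hP.1 i (by omega)).eq_of_src _ _
          · simp [hi, hj] }
  have hN0 : N.f 0 = g' - 𝟙 _ := by simp [N]
  have hN : ∀ i, i ≠ 0 → N.f i = 0 := fun i hi => dif_neg hi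
  have hiso : IsIso (𝟙 P + N) := by
    refine isIso_of_minimal_totalDim k hP hmin _ fun j hj => ?_
    have : QuasiIsoAt (((isProj A).ι.mapHomologicalComplex (ComplexShape.up ℤ)).map (𝟙 P + N))
        j := by
      have h0 : HomologicalComplex.homologyMap
          (((isProj A).ι.mapHomologicalComplex (ComplexShape.up ℤ)).map N) j = 0 :=
        homologyMap_eq_zero _ j ((congrArg (isProj A).ι.map (hN j (by omega))).trans
          ((isProj A).ι.map_zero _ _))
      rw [quasiIsoAt_iff_isIso_homologyMap, Functor.map_add, HomologicalComplex.homologyMap_add,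
        h0, add_zero, CategoryTheory.Functor.map_id, HomologicalComplex.homologyMap_id]
      infer_instance
    rw [← isIso_homology_Q_map] at this
    exact (NatIso.isIso_map_iff (Functor.isoWhiskerRight
      (DerivedCategory.quotientCompQhIso (FGModuleCat.{u} A))
      (DerivedCategory.homologyFunctor _ j)) _).2 this
  apply hL.1
  rw [eq_top_iff]
  rintro x -
  obtain ⟨y, rfl⟩ := surjective_of_isIso ((𝟙 P + N).f 0) x
  have h1 : lin ((𝟙 P + N).f 0) y = g y := by
    have : (𝟙 P + N).f 0 = g' := by
      rw [HomologicalComplex.add_f_apply, hN0, HomologicalComplex.id_f]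
      abel
    rw [this]; rfl
  rw [h1]
  exact (g y).2

/-- Every object with cohomology in degrees `≤ m` has an approximation in `C_m(A-proj)`, whose
dimension is bounded in terms of the cohomology dimension vector. -/
theorem exists_minimal_approximation (m : ℕ) (h : ℤ → ℕ) :
    ∃ N : ℕ, ∀ X : DerivedCategory (FGModuleCat.{u} A), X.IsLE m → cohDim k X = h →
      ∃ P : Cm A m, totalDim k m P.obj ≤ N ∧ IsApproximation m P.obj X := by
  -- The properties of a minimal approximation that do not mention X; the dimension bound depends on
  -- these alone.
  let T : CochainComplex (ProjCat A) ℤ → Prop := fun P =>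
    (∀ i : ℤ, i < 0 ∨ (m : ℤ) < i → IsZero (P.X i)) ∧ IsHomotopyMinimal P ∧
    LinearMap.ker (lin (P.d 0 1)) ≤ Module.jacobson A (P.X 0).obj ∧
    ∀ i : ℤ, 1 ≤ i → dimOver k ((toModCpx P).homology i) = h i
  -- Descending induction on the degree m + 1 - j, starting from the zero term in degree m + 1.
  have bound : ∀ j : ℕ, ∃ N : ℕ, ∀ P, T P → dimOver k (P.X (m + 1 - j)).obj ≤ N := by
    intro j
    induction j with
    | zero =>
      refine ⟨0, fun P hP => (dimOver_eq_zero_of_isZero k ?_).le⟩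
      exact isZero_proj_iff.1 (hP.1 _ (by omega))
    | succ j ih =>
      obtain ⟨N, hN⟩ := ih
      have hi : (m + 1 - (j + 1 : ℕ) : ℤ) + 1 = m + 1 - j := by push_cast; ring
      generalize (m + 1 - (j + 1 : ℕ) : ℤ) = i at *
      rw [← hi] at hN
      rcases lt_trichotomy i 0 with hi0 | rfl | hi0
      · exact ⟨0, fun P hP => (dimOver_eq_zero_of_isZero k
          (isZero_proj_iff.1 (hP.1 _ (Or.inl hi0)))).le⟩
      -- H^0(P) is not controlled by X, so in degree 0 the condition ker d^0 ⊆ rad P^0 replaces the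
      -- cohomological estimate.
      · refine ⟨N * Module.finrank k A, fun P hP => ?_⟩
        exact (dimOver_le_of_le_jacobson k _ hP.2.2.1).trans (Nat.mul_le_mul_right _ (hN P hP))
      · refine ⟨(h i + N) * Module.finrank k A, fun P hP => ?_⟩
        refine (dimOver_X_le k (toModCpx P) i ?_).trans (Nat.mul_le_mul_right _
          (add_le_add (hP.2.2.2 i hi0).le (hN P hP)))
        rintro _ ⟨x, rfl⟩
        exact hP.2.1.d_mem (i - 1) i x
  choose N hN using bound
  refine ⟨∑ i ∈ Finset.Icc (0 : ℤ) m, N (m + 1 - i).toNat, fun X hX hXh => ?_⟩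
  have hex : ∃ d : ℕ, ∃ P, IsApproximation m P X ∧ totalDim k m P = d := by
    obtain ⟨P, hP⟩ := exists_projective_approximation X m
    exact ⟨_, P, hP, rfl⟩
  classical
  obtain ⟨P, hP, hd⟩ := Nat.find_spec hex
  have hmin : ∀ Q, IsApproximation m Q X → totalDim k m P ≤ totalDim k m Q := fun Q hQ =>
    hd.le.trans (Nat.find_le ⟨Q, hQ, rfl⟩)
  have hPm := isHomotopyMinimal_of_minimal_totalDim k hP hmin
  have hT : T P := by
    refine ⟨hP.1, hPm, ker_le_jacobson_of_minimal_totalDim k hP hmin, fun i hi => ?_⟩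
    obtain ⟨_, φ, hφ⟩ := hP
    have := hφ i hi
    rw [← cohDim_cpxToDerived, ← hXh]
    exact dimOver_eq_of_iso k (asIso ((DerivedCategory.homologyFunctor _ i).map φ))
  refine ⟨⟨P, hPm, hP.1⟩, Finset.sum_le_sum fun i hi => ?_, hP⟩
  have := hN (m + 1 - i).toNat P hT
  rw [Finset.mem_Icc] at hi
  have hi' : (m + 1 - ((m + 1 - i).toNat : ℕ) : ℤ) = i := by omega
  rwa [hi'] at this

end Approximation

/-! ### Cohomology dimension vectors with bounded support -/

section Vectors

theorem exists_ne_zero_of_cohRange_pos {h : ℤ → ℕ} (hr : 0 < cohRange h) : ∃ i, h i ≠ 0 := by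
  by_contra! H
  have : cohLength h = 0 := by simp [cohLength, H]
  simp [cohRange, this] at hr

variable {h : ℤ → ℕ} {a b : ℤ} (hab : ∀ i, h i ≠ 0 → a ≤ i ∧ i ≤ b)

include hab

theorem le_cohLength (i : ℤ) : h i ≤ cohLength h := by
  refine le_ciSup (f := h) ?_ i
  have : (Set.range h) ⊆ insert 0 (h '' Set.Icc a b) := by
    rintro _ ⟨j, rfl⟩
    by_cases hj : h j = 0
    · exact Or.inl hj
    · exact Or.inr ⟨j, hab j hj, rfl⟩
  exact (((Set.finite_Icc a b).image h).insert 0).subset this |>.bddAbove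

theorem le_cohWidth {i j : ℤ} (hi : h i ≠ 0) (hj : h j ≠ 0) : j - i + 1 ≤ cohWidth h := by
  by_cases hij : 0 ≤ j - i + 1
  · have hb : BddAbove {n : ℕ | ∃ i j : ℤ, h i ≠ 0 ∧ h j ≠ 0 ∧ (n : ℤ) = j - i + 1} := by
      refine ⟨(b - a + 1).toNat, ?_⟩
      rintro n ⟨i, j, hi, hj, hn⟩
      have := hab i hi
      have := hab j hj
      omega
    have : (j - i + 1).toNat ≤ cohWidth h :=
      le_csSup hb ⟨i, j, hi, hj, Int.toNat_of_nonneg hij⟩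
    omega
  · omega

theorem le_cohRange (hr : 0 < cohRange h) (i : ℤ) : h i ≤ cohRange h :=
  (le_cohLength hab i).trans (Nat.le_mul_of_pos_right _ (Nat.pos_of_mul_pos_left hr))

theorem sub_lt_cohRange (hr : 0 < cohRange h) {i j : ℤ} (hi : h i ≠ 0) (hj : h j ≠ 0) :
    j - i < cohRange h := by
  have h1 := le_cohWidth hab hi hj
  have h2 : cohWidth h ≤ cohRange h :=
    Nat.le_mul_of_pos_left _ (Nat.pos_of_mul_pos_right hr)
  omega

omit hab

theorem finite_vectors (r : ℕ) :
    {h : ℤ → ℕ | ∀ i, h i ≤ r ∧ (h i ≠ 0 → 0 ≤ i ∧ i ≤ r)}.Finite := by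
  -- The cap by r only serves to land in a finite type; it changes no vector of the set, so f is
  -- injective there.
  let f : (ℤ → ℕ) → (Fin (r + 1) → Fin (r + 1)) := fun h i =>
    ⟨min (h (i : ℕ)) r, by omega⟩
  refine Set.Finite.of_injOn (f := f) (t := Set.univ) (fun _ _ => trivial) ?_ Set.finite_univ
  intro h hh h' hh' heq
  ext i
  by_cases hi : 0 ≤ i ∧ i ≤ r
  · have := congrArg Fin.val (congrFun heq ⟨i.toNat, by omega⟩)
    simp only [f, Int.toNat_of_nonneg hi.1] at this
    have h1 := (hh i).1
    have h2 := (hh' i).1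
    omega
  · have h1 : h i = 0 := by by_contra H; exact hi ((hh i).2 H)
    have h2 : h' i = 0 := by by_contra H; exact hi ((hh' i).2 H)
    rw [h1, h2]

end Vectors

/-! ### Discreteness -/

section Discrete

variable (k : Type v) [Field k] {A : Type u} [Ring A] [Algebra k A] [Module.Finite k A]

/-- Isomorphism of shifts. -/
theorem nonempty_iso_shift_of_iso {C : Type*} [Category C] [HasShift C ℤ] {X Y : C} {n n' : ℤ}
    (e : (shiftFunctor C n).obj X ≅ (shiftFunctor C n').obj Y) :
    Nonempty (X ≅ (shiftFunctor C (n' - n)).obj Y) :=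
  ⟨(shiftShiftNeg X n).symm ≪≫ (shiftFunctor C (-n)).mapIso e ≪≫
    ((shiftFunctorAdd' C n' (-n) (n' - n) (by omega)).app Y).symm⟩

section

variable [IsNoetherianRing A]

theorem exists_support_bound (X : Db A) :
    ∃ a b : ℤ, ∀ i, cohDimDb k X i ≠ 0 → a ≤ i ∧ i ≤ b := by
  obtain ⟨⟨a, ha⟩, ⟨b, hb⟩⟩ := X.property
  refine ⟨a, b, fun i hi => ?_⟩
  by_contra H
  apply hi
  refine (cohDim_eq_zero_iff k X.obj i).2 ?_
  by_cases h : i < a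
  · exact X.obj.isZero_of_isGE a i h
  · exact X.obj.isZero_of_isLE b i (by omega)

theorem isBounded_toDerived {X : HomotopyCategory (ProjCat A) (ComplexShape.up ℤ)}
    (hX : IsBoundedComplex X.as) :
    DerivedCategory.TStructure.t.bounded ((toDerived A).obj X) := by
  obtain ⟨a, b, hab⟩ := hX
  have h1 : (toModCpx X.as).IsStrictlyGE a := by
    rw [CochainComplex.isStrictlyGE_iff]
    exact fun i hi => (isProj A).ι.map_isZero (hab i (Or.inl hi))
  have h2 : (toModCpx X.as).IsStrictlyLE b := by
    rw [CochainComplex.isStrictlyLE_iff]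
    exact fun i hi => (isProj A).ι.map_isZero (hab i (Or.inr hi))
  exact ⟨⟨a, DerivedCategory.TStructure.t.isGE_of_iso (cpxToDerivedIso X.as).symm a⟩,
    ⟨b, DerivedCategory.TStructure.t.isLE_of_iso (cpxToDerivedIso X.as).symm b⟩⟩

/-- The object of `D^b(A-mod)` attached to an object of `K^b(A-proj)`. -/
noncomputable def kbToDb (X : Kb A) : Db A :=
  ⟨(toDerived A).obj X.obj, isBounded_toDerived X.property⟩

theorem cohDimDb_kbToDb (X : Kb A) : cohDimDb k (kbToDb X) = cohDimKb k X :=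
  (cohDimKb_eq k X).symm

/-- The full faithfulness of `K^b(A-proj) ⥤ D^b(A-mod)` on isomorphisms up to shift. -/
theorem nonempty_iso_shift_of_toDerived {X Y : Kb A} (n : ℤ)
    (e : (toDerived A).obj X.obj ≅ (shiftFunctor _ n).obj ((toDerived A).obj Y.obj)) :
    Nonempty (X.obj ≅ (shiftFunctor _ n).obj Y.obj) := by
  let Q := HomotopyCategory.quotient (ProjCat A) (ComplexShape.up ℤ)
  let s : Q.obj ((shiftFunctor _ n).obj Y.obj.as) ≅ (shiftFunctor _ n).obj Y.obj :=
    (Q.commShiftIso n).app Y.obj.as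
  -- The shift is represented by the shifted complex itself, whose boundedness can be read off
  -- degreewise.
  have hY : IsBoundedComplex (Q.obj ((shiftFunctor _ n).obj Y.obj.as)).as := by
    obtain ⟨a, b, hab⟩ := Y.property
    exact ⟨a - n, b - n, fun i hi => hab (i + n) (by omega)⟩
  obtain ⟨j⟩ := nonempty_iso_of_toDerived X.property hY
    (e ≪≫ (((toDerived A).commShiftIso n).app Y.obj).symm ≪≫ (toDerived A).mapIso s.symm)
  exact ⟨j ≪≫ s⟩

end

/-- An object with the given vector is determined, after a fixed shift, by an approximation in C_m
of bounded total dimension, and there are finitely many of those. -/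
theorem derivedDiscrete_of_finiteType (hF : ∀ m : ℕ, 1 ≤ m → CmFiniteType A m) :
    DerivedDiscrete k A := by
  have := noetherian_of_finite k A
  intro h
  by_cases hex : ∃ X : Db A, cohDimDb k X = h
  swap
  · exact ⟨∅, Set.finite_empty, fun X hX => absurd ⟨X, hX⟩ hex⟩
  obtain ⟨X₀, rfl⟩ := hex
  obtain ⟨a, b, hab⟩ := exists_support_bound k X₀
  generalize cohDimDb k X₀ = h at hab
  -- Since H^i(X[n]) = H^{n+i}(X), this moves the support from [a, b] into [1, m]; the extra 1 in m
  -- ensures m ≥ 1.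
  let n := a - 1
  let m := (b - a + 1).toNat + 1
  obtain ⟨N, hN⟩ := exists_minimal_approximation (A := A) k m (fun i => h (n + i))
  have hsh : ∀ X : Db A, cohDimDb k X = h →
      cohDim k ((shiftFunctor _ n).obj X.obj) = fun i => h (n + i) := fun X hX => by
    ext i
    rw [cohDim_shift, ← hX]
    rfl
  refine (finiteUpTo_totalDim_le k (hF m (by omega)) N).of_rel (fun (X : Db A) P =>
    IsApproximation m P.obj ((shiftFunctor _ n).obj X.obj) ∧
      ((shiftFunctor _ n).obj X.obj).IsGE 1) ?_ ?_
  · intro X hX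
    have hz : ∀ i : ℤ, ¬ (1 ≤ i ∧ i ≤ m) →
        IsZero ((DerivedCategory.homologyFunctor _ i).obj ((shiftFunctor _ n).obj X.obj)) := by
      intro i hi
      rw [← cohDim_eq_zero_iff k, hsh X hX]
      by_contra H
      have := hab _ H
      omega
    have hLE : ((shiftFunctor _ n).obj X.obj).IsLE m :=
      (DerivedCategory.isLE_iff _ _).2 fun i hi => hz i (by omega)
    have hGE : ((shiftFunctor _ n).obj X.obj).IsGE 1 :=
      (DerivedCategory.isGE_iff _ _).2 fun i hi => hz i (by omega)
    obtain ⟨P, hP, hP'⟩ := hN _ hLE (hsh X hX)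
    exact ⟨P, hP, hP', hGE⟩
  · rintro X X' P P' Q ⟨⟨-, φ, hφ⟩, hX⟩ ⟨⟨-, φ', hφ'⟩, hX'⟩ ⟨e⟩ ⟨e'⟩
    let G : Cm A m ⥤ DerivedCategory (FGModuleCat.{u} A) :=
      (isCm A m).ι ⋙ HomotopyCategory.quotient _ _ ⋙ toDerived A
    let f : cpxToDerived P.obj ≅ cpxToDerived P'.obj := G.mapIso (e ≪≫ e'.symm)
    obtain ⟨i⟩ := nonempty_iso_of_approximation φ (f.hom ≫ φ') hφ (fun i hi => by
      have := hφ' i hi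
      rw [(DerivedCategory.homologyFunctor _ i).map_comp]
      infer_instance) hX hX'
    exact ⟨(DerivedCategory.TStructure.t.bounded).ι.preimageIso
      ((shiftFunctor _ n).preimageIso i)⟩

theorem kbDiscrete_of_derivedDiscrete (hD : DerivedDiscrete k A) : KbDiscrete k A := by
  have := noetherian_of_finite k A
  intro h
  refine (hD h).of_rel (fun (X : Kb A) Y => kbToDb X = Y)
    (fun X hX => ⟨_, (cohDimDb_kbToDb k X).trans hX, rfl⟩) ?_
  rintro X X' _ _ Y rfl rfl ⟨e⟩ ⟨e'⟩
  obtain ⟨i⟩ := nonempty_iso_of_toDerived X.property X'.property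
    ((DerivedCategory.TStructure.t.bounded).ι.mapIso (e ≪≫ e'.symm))
  exact ⟨(isBoundedKb A).ι.preimageIso i⟩

/-- When the lowest nonzero cohomology is shifted to degree 0, a vector of range r > 0 has entries
at most r and support in [0, r], so `finite_vectors` applies. -/
theorem finiteUpTo_shift_of_derivedDiscrete [IsNoetherianRing A] (hD : DerivedDiscrete k A)
    {r : ℕ} (hr : 0 < r) :
    FiniteUpTo IsomorphicUpToShift fun X : Db A => cohRange (cohDimDb k X) = r := by
  refine (FiniteUpTo.biUnion (finite_vectors r) fun h _ => hD h).of_rel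
    (fun (X Y : Db A) => ∃ n : ℤ, Nonempty (Y.obj ≅ (shiftFunctor _ n).obj X.obj)) ?_ ?_
  · rintro X rfl
    obtain ⟨a, b, hab⟩ := exists_support_bound k X
    obtain ⟨n, hn, hmin⟩ := Int.exists_least_of_bdd (P := fun i => cohDimDb k X i ≠ 0)
      ⟨a, fun i hi => (hab i hi).1⟩ (exists_ne_zero_of_cohRange_pos hr)
    let Y : Db A := ⟨(shiftFunctor _ n).obj X.obj,
      DerivedCategory.TStructure.t.bounded.le_shift n _ X.property⟩
    have hY : ∀ i, cohDimDb k Y i = cohDimDb k X (n + i) := cohDim_shift k X.obj n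
    refine ⟨Y, ⟨cohDimDb k Y, fun i => ⟨?_, fun hi => ?_⟩, rfl⟩, n, ⟨Iso.refl _⟩⟩
    · rw [hY]
      exact le_cohRange hab hr _
    · rw [hY] at hi
      have h1 := hmin _ hi
      have h2 := sub_lt_cohRange hab hr hn hi
      omega
  · rintro X X' P P' Y ⟨n, ⟨e⟩⟩ ⟨n', ⟨e'⟩⟩ ⟨f⟩ ⟨f'⟩
    exact ⟨n' - n, nonempty_iso_shift_of_iso
      (e.symm ≪≫ (DerivedCategory.TStructure.t.bounded).ι.mapIso (f ≪≫ f'.symm) ≪≫ e')⟩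

theorem finiteUpTo_shift_kb_of_derivedDiscrete [IsNoetherianRing A] (hD : DerivedDiscrete k A)
    {r : ℕ} (hr : 0 < r) :
    FiniteUpTo IsomorphicUpToShift fun X : Kb A => cohRange (cohDimKb k X) = r := by
  refine (finiteUpTo_shift_of_derivedDiscrete k hD hr).of_rel (fun (X : Kb A) Y => kbToDb X = Y)
    (fun X hX => ⟨_, by rw [cohDimDb_kbToDb, hX], rfl⟩) ?_
  rintro X X' _ _ Y rfl rfl ⟨n, ⟨e⟩⟩ ⟨n', ⟨e'⟩⟩
  obtain ⟨i⟩ := nonempty_iso_shift_of_iso (X := (toDerived A).obj X.obj)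
    (Y := (toDerived A).obj X'.obj) (n := -n) (n' := -n')
    ((shiftFunctor _ (-n)).mapIso e ≪≫ shiftShiftNeg Y.obj n ≪≫
      (shiftShiftNeg Y.obj n').symm ≪≫ ((shiftFunctor _ (-n')).mapIso e').symm)
  exact ⟨_, nonempty_iso_shift_of_toDerived _ i⟩

theorem not_stronglyDerivedUnbounded (hD : DerivedDiscrete k A) :
    ¬ StronglyDerivedUnbounded k A := by
  have := noetherian_of_finite k A
  rintro ⟨r, hr, h⟩
  -- Index 1 guarantees a positive range, as r 1 > r 0 ≥ 0.
  exact h 1 ((finiteUpTo_shift_of_derivedDiscrete k hD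
    ((Nat.zero_le _).trans_lt (hr zero_lt_one))).mono fun X hX => hX.2)

theorem not_kbStronglyUnbounded (hD : DerivedDiscrete k A) : ¬ KbStronglyUnbounded k A := by
  have := noetherian_of_finite k A
  rintro ⟨r, hr, h⟩
  exact h 1 ((finiteUpTo_shift_kb_of_derivedDiscrete k hD
    ((Nat.zero_le _).trans_lt (hr zero_lt_one))).mono fun X hX => hX.2)

end Discrete

/-! ### Indecomposability of images -/

section Images

/-- An idempotent of the image lifts to an endomorphism that is nilpotent or invertible; an
idempotent that is nilpotent is 0, one that is invertible is 1. The lift itself need not be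
idempotent. -/
theorem idempotent_eq_of_map {C D : Type*} [Category C] [Preadditive C] [Category D]
    [Preadditive D] (G : C ⥤ D) [G.PreservesZeroMorphisms] {X : C}
    (hX : ∀ e : End X, IsNilpotent e ∨ IsUnit e)
    (hG : Function.Surjective (G.map : (X ⟶ X) → _)) (q : G.obj X ⟶ G.obj X) (hq : q ≫ q = q) :
    q = 0 ∨ q = 𝟙 _ := by
  obtain ⟨e, rfl⟩ := hG q
  have hq' : IsIdempotentElem (G.mapEnd X e) := hq
  rcases hX e with ⟨n, hn⟩ | he
  · left
    have h := hq'.pow_succ_eq n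
    rw [← map_pow, pow_succ, hn, zero_mul] at h
    exact h.symm.trans (G.map_zero X X)
  · right
    exact (he.map (G.mapEnd X)).mul_left_cancel (hq.trans (mul_one (G.mapEnd X e)).symm)

theorem isIndecomposable_fullSubcategory {C : Type*} [Category C] [Preadditive C]
    {P : ObjectProperty C} (X : P.FullSubcategory) (hX : 𝟙 X.obj ≠ 0)
    (h : ∀ q : X.obj ⟶ X.obj, q ≫ q = q → q = 0 ∨ q = 𝟙 _) : IsIndecomposable X := by
  refine isIndecomposable_of_idempotents
    (fun hz => hX (congrArg (fun f => f.hom) ((IsZero.iff_id_eq_zero X).1 hz))) fun q hq => ?_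
  refine (h q.hom (congrArg (fun f => f.hom) hq)).imp (fun h => ?_) fun h => ?_
  · ext1; exact h
  · ext1; exact h

variable (k : Type v) [Field k] {A : Type u} [Ring A] [Algebra k A] [Module.Finite k A]
  [IsNoetherianRing A] {m : ℕ}

/-- The object of `K^b(A-proj)` attached to an object of `C_m(A-proj)`. -/
def cmToKb (X : Cm A m) : Kb A :=
  ⟨(HomotopyCategory.quotient _ _).obj X.obj, 0, m, X.property.2⟩

theorem cohDimKb_cmToKb (X : Cm A m) : cohDimKb k (cmToKb X) = cohDimCm k X :=
  (cohDimKb_eq k _).trans (cohDimCm_eq k X).symm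

theorem nonempty_iso_of_cmToKb {X Y : Cm A m} (e : (cmToKb X).obj ≅ (cmToKb Y).obj) :
    Nonempty (X ≅ Y) := by
  obtain ⟨i⟩ := X.property.1.nonempty_iso Y.property.1 (HomotopyCategory.homotopyEquivOfIso e)
  exact ⟨(isCm A m).ι.preimageIso i⟩

-- The functors to K^b and D^b are full on the endomorphisms of X, so idempotents of the images are
-- trivial. The images are nonzero because a minimal complex whose identity is null-homotopic is
-- zero.
include k in
theorem isIndecomposable_cmToKb {X : Cm A m} (hX : IsIndecomposable X) :
    IsIndecomposable (cmToKb X) ∧ IsIndecomposable (kbToDb (cmToKb X)) := by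
  have hid : ∀ q : X.obj ⟶ X.obj, q ≫ q = q → q = 0 ∨ q = 𝟙 X.obj := fun q hq => by
    refine (hX.idempotent_eq (ObjectProperty.homMk q) (by ext1; exact hq)).imp ?_ ?_ <;>
    exact congrArg fun f : X ⟶ X => f.hom
  have hend := nilpotent_or_isIso k X.property.2 hid
  let Q := HomotopyCategory.quotient (ProjCat A) (ComplexShape.up ℤ)
  have h0 : 𝟙 (Q.obj X.obj) ≠ 0 := by
    intro h
    have h1 : Q.map (0 : X.obj ⟶ X.obj) = Q.map (𝟙 X.obj) :=
      (Q.map_zero _ _).trans (h.symm.trans (Q.map_id _).symm)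
    have h2 := X.property.1.isIso_of_homotopy (HomotopyCategory.homotopyOfEq _ _ h1)
    refine hX.1 ((IsZero.iff_id_eq_zero X).2 ?_)
    ext1
    exact isIsoZeroSelfEquiv X.obj h2
  have hsurj : Function.Surjective (Q.map : (X.obj ⟶ X.obj) → _) := Q.map_surjective
  have hbij := toDerived_map_bijective (cmToKb X).property (cmToKb X).obj
  refine ⟨isIndecomposable_fullSubcategory _ h0 (idempotent_eq_of_map Q hend hsurj),
    isIndecomposable_fullSubcategory _ ?_
      (idempotent_eq_of_map (Q ⋙ toDerived A) hend (hbij.2.comp hsurj))⟩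
  intro h
  exact h0 (hbij.1 (((toDerived A).map_id _).trans (h.trans ((toDerived A).map_zero _ _).symm)))

end Images

/-! ### Unboundedness -/

section Unbounded

variable (k : Type v) [Field k] {A : Type u} [Ring A] [Algebra k A] [Module.Finite k A]

section

variable [IsNoetherianRing A] {m : ℕ}

theorem cohDimCm_support (X : Cm A m) (i : ℤ) (hi : cohDimCm k X i ≠ 0) : 0 ≤ i ∧ i ≤ m := by
  by_contra H
  apply hi
  refine dimOver_eq_zero_iff k |>.2 ?_
  exact ShortComplex.isZero_homology_of_isZero_X₂ _
    ((isProj A).ι.map_isZero (X.property.2 i (by omega)))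

/-- Only finitely many shifts of an object have nonzero cohomology in degrees `0, …, m` only. -/
theorem finiteUpTo_of_iso_shift {S : Set (DerivedCategory (FGModuleCat.{u} A))} (hS : S.Finite)
    {P : Cm A m → Prop} (hr : ∀ X, P X → 0 < cohRange (cohDimCm k X))
    (h : ∀ X, P X → ∃ Y ∈ S, ∃ n : ℤ, Nonempty (cpxToDerived X.obj ≅ (shiftFunctor _ n).obj Y)) :
    FiniteUpTo Isomorphic P := by
  classical
  -- A degree in which Y has cohomology. If Y[n] has cohomology only in degrees 0, …, m, then 0 ≤ d
  -- Y - n ≤ m, which leaves finitely many n. The default 0 is never relevant: positive range makes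
  -- the cohomology of Y nonzero.
  let d : DerivedCategory (FGModuleCat.{u} A) → ℤ := fun Y =>
    if h : ∃ j, cohDim k Y j ≠ 0 then h.choose else 0
  refine (FiniteUpTo.biUnion (r := Eq) hS (P := fun Y (p : DerivedCategory _ × ℤ) =>
    p ∈ ({Y} : Set _) ×ˢ Set.Icc (d Y - m) (d Y)) fun Y _ => finiteUpTo_eq_of_finite
      ((Set.finite_singleton Y).prod (Set.finite_Icc _ _))).of_rel
    (fun X p => Nonempty (cpxToDerived X.obj ≅ (shiftFunctor _ p.2).obj p.1)) ?_ ?_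
  · intro X hX
    obtain ⟨Y, hY, n, ⟨e⟩⟩ := h X hX
    have hc : ∀ i, cohDimCm k X i = cohDim k Y (n + i) := fun i => by
      rw [cohDimCm_eq, cohDim_eq_of_iso k e, cohDim_shift]
    have hex : ∃ j, cohDim k Y j ≠ 0 := by
      obtain ⟨i, hi⟩ := exists_ne_zero_of_cohRange_pos (hr X hX)
      exact ⟨n + i, by rwa [← hc]⟩
    have hd : cohDim k Y (d Y) ≠ 0 := by
      simp only [d, dif_pos hex]
      exact hex.choose_spec
    have := cohDimCm_support k X (d Y - n) (by rwa [hc, add_sub_cancel])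
    exact ⟨(Y, n), ⟨Y, hY, rfl, by constructor <;> simp only <;> omega⟩, ⟨e⟩⟩
  · rintro X X' p _ _ ⟨e⟩ ⟨e'⟩ rfl rfl
    obtain ⟨i⟩ := nonempty_iso_of_toDerived (cmToKb X).property (cmToKb X').property (e ≪≫ e'.symm)
    exact nonempty_iso_of_cmToKb i

theorem finiteUpTo_cm_of_kbDiscrete (hD : KbDiscrete k A) {r : ℕ} (hr : 0 < r) :
    FiniteUpTo Isomorphic fun X : Cm A m => cohRange (cohDimCm k X) = r := by
  -- Entries are bounded by r and the support lies in [0, m]; the maximum covers both constraints.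
  refine (FiniteUpTo.biUnion (finite_vectors (max r m)) fun h _ => hD h).of_rel
    (fun (X : Cm A m) Y => cmToKb X = Y) ?_ ?_
  · rintro X rfl
    refine ⟨_, ⟨_, fun i => ⟨?_, fun hi => ?_⟩, cohDimKb_cmToKb k X⟩, rfl⟩
    · exact (le_cohRange (cohDimCm_support k X) hr i).trans (le_max_left _ _)
    · have := cohDimCm_support k X i hi
      omega
  · rintro X X' _ _ Y rfl rfl ⟨e⟩ ⟨e'⟩
    exact nonempty_iso_of_cmToKb ((isBoundedKb A).ι.mapIso (e ≪≫ e'.symm))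

end

variable {k} {m : ℕ}

theorem CmStronglyUnbounded.not_kbDiscrete (h : CmStronglyUnbounded k A m) :
    ¬ KbDiscrete k A := by
  have := noetherian_of_finite k A
  intro hD
  obtain ⟨r, hr, h⟩ := h
  exact h 1 ((finiteUpTo_cm_of_kbDiscrete k hD
    ((Nat.zero_le _).trans_lt (hr zero_lt_one))).mono fun X hX => hX.2)

theorem CmStronglyUnbounded.not_cmFiniteType (h : CmStronglyUnbounded k A m) :
    ¬ CmFiniteType A m := by
  intro hF
  obtain ⟨r, -, h⟩ := h
  exact h 0 (hF.mono fun X hX => hX.1)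

theorem CmStronglyUnbounded.stronglyDerivedUnbounded (h : CmStronglyUnbounded k A m) :
    StronglyDerivedUnbounded k A := by
  have := noetherian_of_finite k A
  obtain ⟨r, hr, h⟩ := h
  -- Dropping the first term makes every range positive, as required to bound the possible shifts.
  refine ⟨fun i => r (i + 1), fun i j hij => hr (by omega), fun i ⟨S, hS, hS'⟩ => h (i + 1) ?_⟩
  refine finiteUpTo_of_iso_shift k (hS.image fun Y => Y.obj) (fun X hX => ?_) fun X hX => ?_
  · rw [hX.2]
    exact (Nat.zero_le _).trans_lt (hr i.succ_pos)
  · obtain ⟨Y, hY, n, e⟩ := hS' (kbToDb (cmToKb X)) ⟨(isIndecomposable_cmToKb k hX.1).2, by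
      rw [cohDimDb_kbToDb, cohDimKb_cmToKb, hX.2]⟩
    exact ⟨_, ⟨Y, hY, rfl⟩, n, e⟩

theorem CmStronglyUnbounded.kbStronglyUnbounded (h : CmStronglyUnbounded k A m) :
    KbStronglyUnbounded k A := by
  have := noetherian_of_finite k A
  obtain ⟨r, hr, h⟩ := h
  refine ⟨fun i => r (i + 1), fun i j hij => hr (by omega), fun i ⟨S, hS, hS'⟩ => h (i + 1) ?_⟩
  refine finiteUpTo_of_iso_shift k (hS.image fun Y => (toDerived A).obj Y.obj) (fun X hX => ?_)
    fun X hX => ?_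
  · rw [hX.2]
    exact (Nat.zero_le _).trans_lt (hr i.succ_pos)
  · obtain ⟨Y, hY, n, ⟨e⟩⟩ := hS' (cmToKb X) ⟨(isIndecomposable_cmToKb k hX.1).1, by
      rw [cohDimKb_cmToKb, hX.2]⟩
    exact ⟨_, ⟨Y, hY, rfl⟩, n,
      ⟨(toDerived A).mapIso e ≪≫ ((toDerived A).commShiftIso n).app Y.obj⟩⟩

end Unbounded

end DerivedRep

theorem mainTheorem5 (k : Type v) [Field k] [Infinite k] (A : Type u) [Ring A] [Algebra k A]
    [Module.Finite k A] (hA : DerivedRep.IsCDichotomic k A) :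
    ((DerivedRep.DerivedDiscrete k A ↔ DerivedRep.KbDiscrete k A) ∧
      (DerivedRep.KbDiscrete k A ↔ ∀ m : ℕ, 1 ≤ m → DerivedRep.CmFiniteType A m)) ∧
    ((DerivedRep.StronglyDerivedUnbounded k A ↔ DerivedRep.KbStronglyUnbounded k A) ∧
      (DerivedRep.KbStronglyUnbounded k A ↔
        ∃ m : ℕ, 1 ≤ m ∧ DerivedRep.CmStronglyUnbounded k A m)) := by
  open DerivedRep in
  rcases hA with hF | ⟨m, hm, hU⟩
  · have hD := derivedDiscrete_of_finiteType k hF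
    have hK := kbDiscrete_of_derivedDiscrete k hD
    exact ⟨⟨iff_of_true hD hK, iff_of_true hK hF⟩,
      iff_of_false (not_stronglyDerivedUnbounded k hD) (not_kbStronglyUnbounded k hD),
      iff_of_false (not_kbStronglyUnbounded k hD)
        fun ⟨m, hm, hU⟩ => hU.not_cmFiniteType (hF m hm)⟩
  · exact ⟨⟨iff_of_false (fun hD => hU.not_kbDiscrete (kbDiscrete_of_derivedDiscrete k hD))
        hU.not_kbDiscrete,
      iff_of_false hU.not_kbDiscrete fun hF => hU.not_cmFiniteType (hF m hm)⟩,
      iff_of_true hU.stronglyDerivedUnbounded hU.kbStronglyUnbounded,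
      iff_of_true hU.kbStronglyUnbounded ⟨m, hm, hU⟩⟩
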